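/- Let $p,q\ge 2$ be integers. For $\beta,h\in\mathbb R$ and $N\ge 1$, the $p$-tensor Curie–Weiss Potts model is the probability measure on $\{1,\dots,q\}^N$ given by $$\mathbb P_{\beta,h,N}(X)\ \propto\ \exp\Big(\beta N\sum_{r=1}^q \bar X_{\cdot r}^{\,p}+Nh\,\bar X_{\cdot 1}\Big),\qquad \bar X_{\cdot r}:=\frac1N\#\{i: X_i=r\},$$ and $\bar X_N:=(\bar X_{\cdot 1},\dots,\bar X_{\cdot q})$. Let $\mathcal P_q$ be the set of probability vectors in $\mathbb R^q$ and, with $0\log 0=0$, let $$H_{\beta,h}(t):=\beta\sum_{r=1}^q t_r^p+ht_1-\sum_{r=1}^q t_r\log t_r\qquad(t\in\mathcal P_q).$$ Let $(\beta,h)\in(0,\infty)\times[0,\infty)$ be regular, that is, $H_{\beta,h}$ has a unique global maximizer $m_*$ on $\mathcal P_q$ and $$\sum_{r=1}^q\Big(\beta p(p-1)m_{*,r}^{p-2}-\frac1{m_{*,r}}\Big)t_r^2<0\quad\text{for all } t\in\mathbb R^q\setminus\{0\}\text{ with }\sum_{r=1}^q t_r=0 .$$ Then $m_*=x_s:=\big(\tfrac{1+(q-1)s}{q},\tfrac{1-s}{q},\dots,\tfrac{1-s}{q}\big)$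 for some (necessarily unique) $s\in[0,1)$. Put $f_{\beta,h}(u):=H_{\beta,h}(x_u)$, $k(x):=\beta x^p-x\log x$, $\rho:=k''\big(\tfrac{1+(q-1)s}{q}\big)\big/k''\big(\tfrac{1-s}{q}\big)$ (if $q=2$, then $\rho$ does not occur below), and let $\Sigma$ be the positive semidefinite $q\times q$ matrix $$\Sigma:=\Big(-\frac{q^2}{q-1}f''_{\beta,h}(s)\Big)^{-1}M,$$ where $M_{11}=q-1$, $M_{1r}=M_{r1}=-1$ and $M_{rr}=1+(q-2)\rho$ for $r\ge2$, and $M_{rr'}=-\rho$ for distinct $r,r'\ge2$. Let $\bar\beta,\bar h\in\mathbb R$, and for each $N$ let $X\sim\mathbb P_{\beta+N^{-1/2}\bar\beta,\;h+N^{-1/2}\bar h,\;N}$. Then, as $N\to\infty$, $$\sqrt N\,(\bar X_N-m_*)\ \xrightarrow{D}\ \mathcal N_q\big(\Sigma(\bar\beta p\,m_*^{p-1}+\bar h e_1),\ \Sigma\big),$$ where $m_*^{p-1}$ is the entrywise power and $e_1=(1,0,\dots,0)$. Moreover all mixed moments converge: for every $a\in\mathbb Z_{\ge0}^q$, $$\mathbb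 E\Big[\prod_{r=1}^q\big(\sqrt N(\bar X_{\cdot r}-m_{*,r})\big)^{a_r}\Big]\ \longrightarrow\ \mathbb E\Big[\prod_{r=1}^q W_r^{a_r}\Big],\qquad W\sim\mathcal N_q\big(\Sigma(\bar\beta p\,m_*^{p-1}+\bar h e_1),\Sigma\big),$$ the right-hand side being finite. -/

import Mathlib

open MeasureTheory ProbabilityTheory Filter Topology

noncomputable section

namespace TensorPotts

/-- The empirical magnetization vector of a configuration `X` of `N` sites with colours in `Fin q`:
its `r`-th entry is the proportion of the sites that have colour `r`. -/
def magnetization {N q : ℕ} (X : Fin N → Fin q) (r : Fin q) : ℝ :=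
  (∑ i, if X i = r then (1 : ℝ) else 0) / N

/-- The unnormalized weight of a configuration in the `p`-tensor Curie-Weiss Potts model.
The distinguished first colour is `0 : Fin q`. -/
def weight (p : ℕ) {N q : ℕ} [NeZero q] (β h : ℝ) (X : Fin N → Fin q) : ℝ :=
  Real.exp (β * N * ∑ r, magnetization X r ^ p + N * h * magnetization X 0)

/-- The total mass of the weights, that is, the normalizing constant `q ^ N * Z_N(β, h)`. -/
def totalWeight (p q N : ℕ) [NeZero q] (β h : ℝ) : ℝ :=
  ∑ X : Fin N → Fin q, weight p β h X

/-- The `p`-tensor Curie-Weiss Potts model: the probability measure on configurations which gives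
each configuration a mass proportional to its weight. -/
def pottsMeasure (p q N : ℕ) [NeZero q] (β h : ℝ) : Measure (Fin N → Fin q) :=
  ∑ X : Fin N → Fin q, ENNReal.ofReal (weight p β h X / totalWeight p q N β h) • Measure.dirac X

theorem totalWeight_pos (p q N : ℕ) [NeZero q] (β h : ℝ) : 0 < totalWeight p q N β h :=
  Finset.sum_pos (fun _ _ => Real.exp_pos _) Finset.univ_nonempty

instance isProbabilityMeasure_pottsMeasure (p q N : ℕ) [NeZero q] (β h : ℝ) :
    IsProbabilityMeasure (pottsMeasure p q N β h) := by
  constructor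
  have hZ := totalWeight_pos p q N β h
  have key : (∑ X : Fin N → Fin q, weight p β h X / totalWeight p q N β h) = 1 := by
    rw [← Finset.sum_div]
    exact div_self hZ.ne'
  have hnn : ∀ X ∈ (Finset.univ : Finset (Fin N → Fin q)),
      0 ≤ weight p β h X / totalWeight p q N β h :=
    fun X _ => div_nonneg (Real.exp_pos _).le hZ.le
  simp [pottsMeasure, ← ENNReal.ofReal_sum_of_nonneg hnn, key]

/-- The negative free energy function `H_{β,h}`, considered on `stdSimplex ℝ (Fin q)`. -/
def negFreeEnergy (p : ℕ) {q : ℕ} [NeZero q] (β h : ℝ) (t : Fin q → ℝ) : ℝ :=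
  β * ∑ r, t r ^ p + h * t 0 - ∑ r, t r * Real.log (t r)

/-- The set of all global maximizers of `H_{β,h}` over the probability vectors. -/
def maximizers (p q : ℕ) [NeZero q] (β h : ℝ) : Set (Fin q → ℝ) :=
  {m | m ∈ stdSimplex ℝ (Fin q) ∧ IsMaxOn (negFreeEnergy p β h) (stdSimplex ℝ (Fin q)) m}

/-- The quadratic form `Q_{s,β}`. -/
def quadForm (p : ℕ) {q : ℕ} (β : ℝ) (s t : Fin q → ℝ) : ℝ :=
  ∑ r, (β * p * ((p : ℝ) - 1) * s r ^ (p - 2) - 1 / s r) * t r ^ 2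

/-- Regular points `(β, h)` of the parameter space `(0, ∞) × [0, ∞)`: the function `H_{β,h}` has a
unique global maximizer `m`, and `Q_{m,β}` is negative definite on the sum-zero hyperplane. -/
def IsRegular (p q : ℕ) [NeZero q] (β h : ℝ) : Prop :=
  0 < β ∧ 0 ≤ h ∧ ∃ m : Fin q → ℝ, maximizers p q β h = {m} ∧
    ∀ t : Fin q → ℝ, ∑ r, t r = 0 → t ≠ 0 → quadForm p β m t < 0

/-- The vector `x_s = ((1 + (q - 1) s) / q, (1 - s) / q, …, (1 - s) / q)`. -/
def xvec (q : ℕ) [NeZero q] (s : ℝ) (r : Fin q) : ℝ :=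
  if r = 0 then (1 + ((q : ℝ) - 1) * s) / q else (1 - s) / q

/-- The function `f_{β,h}(s) = H_{β,h}(x_s)`. -/
def fFun (p q : ℕ) [NeZero q] (β h s : ℝ) : ℝ :=
  negFreeEnergy p β h (xvec q s)

/-- The function `k(x) = β x ^ p - x log x`. -/
def kFun (p : ℕ) (β x : ℝ) : ℝ :=
  β * x ^ p - x * Real.log x

/-- The quotient `k''((1 + (q - 1) s) / q) / k''((1 - s) / q)`. -/
def kRatio (p q : ℕ) (β s : ℝ) : ℝ :=
  iteratedDeriv 2 (kFun p β) ((1 + ((q : ℝ) - 1) * s) / q) /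
    iteratedDeriv 2 (kFun p β) ((1 - s) / q)

/-- The limiting covariance matrix `Σ`. -/
def sigmaMatrix (p q : ℕ) [NeZero q] (β h s : ℝ) : Matrix (Fin q) (Fin q) ℝ :=
  (-((q : ℝ) ^ 2 / ((q : ℝ) - 1)) * iteratedDeriv 2 (fFun p q β h) s)⁻¹ •
    Matrix.of fun i j =>
      if i = 0 ∧ j = 0 then (q : ℝ) - 1
      else if i = 0 ∨ j = 0 then -1
      else if i = j then 1 + ((q : ℝ) - 2) * kRatio p q β s
      else -kRatio p q β s

/-- The vector `β̄ p m ^ (p - 1) + h̄ e_1`, with the power taken entrywise. -/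
def driftVec (p : ℕ) {q : ℕ} [NeZero q] (βbar hbar : ℝ) (m : Fin q → ℝ) (r : Fin q) : ℝ :=
  βbar * p * m r ^ (p - 1) + hbar * (if r = 0 then 1 else 0)

/-- The rescaled magnetization `√N (X̄_N - m)`. -/
def fluctuation {q : ℕ} (m : Fin q → ℝ) (N : ℕ) (X : Fin N → Fin q) : EuclideanSpace ℝ (Fin q) :=
  WithLp.toLp 2 fun r => √(N : ℝ) * (magnetization X r - m r)

/-- The model with the perturbed parameters `β + N ^ (-1/2) β̄` and `h + N ^ (-1/2) h̄`. -/
abbrev perturbedPotts (p q : ℕ) [NeZero q] (β h βbar hbar : ℝ) (N : ℕ) :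
    Measure (Fin N → Fin q) :=
  pottsMeasure p q N (β + βbar / √(N : ℝ)) (h + hbar / √(N : ℝ))

/-- The limiting normal law on `ℝ^q`, with mean `Σ (β̄ p m ^ (p - 1) + h̄ e_1)` and
covariance `Σ`. -/
abbrev limitLaw (p q : ℕ) [NeZero q] (β h βbar hbar s : ℝ) (m : Fin q → ℝ) :
    Measure (EuclideanSpace ℝ (Fin q)) :=
  multivariateGaussian
    (WithLp.toLp 2 ((sigmaMatrix p q β h s).mulVec (driftVec p βbar hbar m)))
    (sigmaMatrix p q β h s)

end TensorPotts

end

noncomputable section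

namespace TensorPotts

/-! The proof is a local limit theorem by Laplace's method. The magnetization lives on the lattice
points `k / N` with `∑ k = N`, and the mass of such a point is a multinomial coefficient times an
exponential. Stirling's formula turns it into `localDensity`, up to a factor independent of `k`: a
prefactor times the exponential of `N` times the difference of the perturbed energies at `k / N` and
at `m` (`multinomial_mul_exp_eq`).

For `k / N = m + u / √N` with `∑ u = 0` the first order term vanishes by the Lagrange equations, the
second order term tends to half of `quadForm p β m u`, and the perturbation of order `N ^ (-1/2)` of
the parameters leaves the linear term `driftVec · u` (`tendsto_localDensity`). Uniqueness of the
maximizer and negative definiteness make the energy decay quadratically on the whole simplex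
(`exists_negFreeEnergy_sub_le`), which gives a Gaussian bound on the density, uniform in `N`
(`exists_localDensity_le`). Written as integrals of step functions over `ℝ ^ (q - 1)`, the sums over
`k` converge by dominated convergence against every continuous test function of at most exponential
growth (`tendsto_sum_localDensity`). Dividing by the case of the test function `1` removes all
normalizing constants. Bounded continuous functions and monomials are both admissible, so weak
convergence and convergence of moments come from one statement.

It remains to recognize the limit, whose density on the sum-zero hyperplane is proportional to `exp
(Q u / 2 + v · u)`. The matrix `Σ` inverts `-Q` on that hyperplane
(`isHyperplaneInverse_sigmaMatrix`), so completing the square gives the moment generating function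
of the normal law (`densityLaw_eq_multivariateGaussian`). The form `x_s` of the maximizer comes from
permutation symmetry (`exists_eq_xvec`). -/

/-! ### Symmetry and location of the maximizer. -/

theorem sum_eq_zero_add_const {q : ℕ} [NeZero q] (f : Fin q → ℝ) (c : ℝ)
    (hf : ∀ r, r ≠ 0 → f r = c) : ∑ r, f r = f 0 + ((q : ℝ) - 1) * c := by
  rw [← Finset.add_sum_erase _ _ (Finset.mem_univ (0 : Fin q)),
    Finset.sum_congr rfl (fun r hr => hf r (Finset.ne_of_mem_erase hr))]
  have : 1 ≤ q := NeZero.one_le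
  simp [Finset.card_erase_of_mem, Nat.cast_sub this]

theorem xvec_zero (q : ℕ) [NeZero q] (s : ℝ) :
    xvec q s 0 = (1 + ((q : ℝ) - 1) * s) / q := by simp [xvec]

theorem xvec_of_ne {q : ℕ} [NeZero q] (s : ℝ) {r : Fin q} (hr : r ≠ 0) :
    xvec q s r = (1 - s) / q := by simp [xvec, hr]

theorem sum_xvec (q : ℕ) [NeZero q] (s : ℝ) : ∑ r, xvec q s r = 1 := by
  rw [sum_eq_zero_add_const _ _ (fun r hr => xvec_of_ne s hr), xvec_zero]
  have : (q : ℝ) ≠ 0 := NeZero.ne _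
  field_simp
  ring

theorem xvec_pos {q : ℕ} [NeZero q] {s : ℝ} (hs : s ∈ Set.Ico (0 : ℝ) 1) (r : Fin q) :
    0 < xvec q s r := by
  have hq : (1 : ℝ) ≤ q := by exact_mod_cast (NeZero.one_le : 1 ≤ q)
  have hs1 := hs.2
  have hs0 := hs.1
  unfold xvec
  split_ifs
  · have := mul_nonneg (sub_nonneg.2 hq) hs0
    positivity
  · exact div_pos (by linarith) (by linarith)

/-- Only the field term distinguishes the colours; everything else is a symmetric function of the
entries. -/
theorem negFreeEnergy_comp_perm (p : ℕ) {q : ℕ} [NeZero q] (β h : ℝ) (t : Fin q → ℝ)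
    (σ : Equiv.Perm (Fin q)) :
    negFreeEnergy p β h (t ∘ σ) = negFreeEnergy p β h t + h * (t (σ 0) - t 0) := by
  unfold negFreeEnergy
  have h1 : ∑ r, (t ∘ σ) r ^ p = ∑ r, t r ^ p := Equiv.sum_comp σ (fun r => t r ^ p)
  have h2 : ∑ r, (t ∘ σ) r * Real.log ((t ∘ σ) r) = ∑ r, t r * Real.log (t r) :=
    Equiv.sum_comp σ (fun r => t r * Real.log (t r))
  rw [h1, h2]
  simp only [Function.comp]
  ring

theorem comp_perm_mem_stdSimplex {q : ℕ} {t : Fin q → ℝ} (ht : t ∈ stdSimplex ℝ (Fin q))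
    (σ : Equiv.Perm (Fin q)) : t ∘ σ ∈ stdSimplex ℝ (Fin q) :=
  ⟨fun r => ht.1 (σ r), (Equiv.sum_comp σ t).trans ht.2⟩

/-- A permutation which does not decrease the energy of the unique maximizer fixes it. -/
theorem comp_perm_eq_of_maximizers_eq {p q : ℕ} [NeZero q] {β h : ℝ} {m : Fin q → ℝ}
    (hm : maximizers p q β h = {m}) (σ : Equiv.Perm (Fin q)) (hσ : 0 ≤ h * (m (σ 0) - m 0)) :
    m ∘ σ = m := by
  have hmm : m ∈ maximizers p q β h := by rw [hm]; rfl
  have : m ∘ σ ∈ maximizers p q β h := by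
    refine ⟨comp_perm_mem_stdSimplex hmm.1 σ, fun t ht => ?_⟩
    have := hmm.2 ht
    simp only [Set.mem_ofPred_eq] at this ⊢
    rw [negFreeEnergy_comp_perm]
    linarith
  rw [hm] at this
  exact this

theorem negFreeEnergy_xvec (p q : ℕ) [NeZero q] (β h s : ℝ) :
    negFreeEnergy p β h (xvec q s) =
      kFun p β ((1 + ((q : ℝ) - 1) * s) / q) + ((q : ℝ) - 1) * kFun p β ((1 - s) / q) +
        h * ((1 + ((q : ℝ) - 1) * s) / q) := by
  unfold negFreeEnergy kFun
  rw [sum_eq_zero_add_const (fun r => xvec q s r ^ p) _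
      (fun r hr => congrArg (· ^ p) (xvec_of_ne s hr)),
    sum_eq_zero_add_const (fun r => xvec q s r * Real.log (xvec q s r)) _
      (fun r hr => congrArg (fun x => x * Real.log x) (xvec_of_ne s hr))]
  simp only [xvec_zero]
  ring

theorem xvec_mem_stdSimplex {q : ℕ} [NeZero q] {s : ℝ} (hs : s ∈ Set.Icc (0 : ℝ) 1) :
    xvec q s ∈ stdSimplex ℝ (Fin q) := by
  refine ⟨fun r => ?_, sum_xvec q s⟩
  have hq : (1 : ℝ) ≤ q := by exact_mod_cast (NeZero.one_le : 1 ≤ q)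
  have hs1 := hs.2
  have hs0 := hs.1
  unfold xvec
  split_ifs
  · have := mul_nonneg (sub_nonneg.2 hq) hs0
    positivity
  · exact div_nonneg (by linarith) (by linarith)

/-- The vertex `x_1` of the simplex is not a maximizer: the entropy has infinite slope there. -/
theorem xvec_one_notMem_maximizers {p q : ℕ} [NeZero q] (hp : 2 ≤ p) (hq : 2 ≤ q) {β h : ℝ}
    (hβ : 0 < β) (hh : 0 ≤ h) : xvec q 1 ∉ maximizers p q β h := by
  intro hmax
  have hq2 : (2 : ℝ) ≤ q := by exact_mod_cast hq
  have hq0 : (0 : ℝ) < q := by linarith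
  -- Move mass `y = (q - 1) e / q` away from the first colour. This costs at most `(β p + h) y = (A
  -- - 1) y`, while `e = exp (-A)` makes the entropy gain at least `A y`.
  set A : ℝ := β * p + h + 1 with hA
  have hA1 : 1 ≤ A := by
    have : 0 ≤ β * p := by positivity
    linarith
  set e : ℝ := Real.exp (-A) with he
  have he0 : 0 < e := Real.exp_pos _
  have he1 : e < 1 := by rw [he, Real.exp_lt_one_iff]; linarith
  have hin : xvec q (1 - e) ∈ stdSimplex ℝ (Fin q) :=
    xvec_mem_stdSimplex ⟨by linarith, by linarith⟩
  have hle := hmax.2 hin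
  simp only [Set.mem_ofPred_eq, negFreeEnergy_xvec] at hle
  set y : ℝ := ((q : ℝ) - 1) * (e / q) with hy
  have hy0 : 0 < y := mul_pos (by linarith) (by positivity)
  have hx : (1 + ((q : ℝ) - 1) * (1 - e)) / q = 1 - y := by rw [hy]; field_simp; ring
  have hx1 : (1 + ((q : ℝ) - 1) * 1) / q = 1 := by field_simp; ring
  have hz : (1 - (1 - e)) / (q : ℝ) = e / q := by ring
  have hy1 : y ≤ 1 := by
    rw [hy, ← mul_div_assoc, div_le_one hq0]
    nlinarith
  rw [hx, hx1, hz] at hle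
  have hk1 : kFun p β 1 = β := by simp [kFun]
  have hk0 : kFun p β ((1 - 1) / q) = 0 := by
    simp [kFun, show p ≠ 0 by omega]
  rw [hk1, hk0] at hle
  have hb : β * (1 - p * y) ≤ kFun p β (1 - y) := by
    unfold kFun
    have h1 : 1 + (p : ℝ) * (-y) ≤ (1 + (-y)) ^ p := one_add_mul_le_pow (by linarith) p
    have h2 : (1 - y) * Real.log (1 - y) ≤ 0 :=
      mul_nonpos_of_nonneg_of_nonpos (by linarith)
        (Real.log_nonpos (by linarith) (by linarith))
    have h3 : β * (1 - p * y) ≤ β * (1 - y) ^ p := by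
      apply mul_le_mul_of_nonneg_left _ hβ.le
      simpa [sub_eq_add_neg] using h1
    linarith
  have hk : e / q * A ≤ kFun p β (e / q) := by
    unfold kFun
    have h1 : Real.log (e / q) ≤ -A := by
      rw [Real.log_div he0.ne' hq0.ne', he, Real.log_exp]
      linarith [Real.log_nonneg (show (1 : ℝ) ≤ q by linarith)]
    have h2 : 0 ≤ β * (e / q) ^ p := by positivity
    nlinarith [mul_le_mul_of_nonneg_left h1 (show 0 ≤ e / q by positivity)]
  have hk' : y * A ≤ ((q : ℝ) - 1) * kFun p β (e / q) := by
    rw [hy, mul_assoc]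
    exact mul_le_mul_of_nonneg_left hk (by linarith)
  have : y * A ≤ y * (A - 1) := by
    rw [hA]
    linarith
  nlinarith

/-- At a regular point the maximizer is `x_s` for some `s ∈ [0, 1)`. -/
theorem exists_eq_xvec {p q : ℕ} [NeZero q] (hp : 2 ≤ p) (hq : 2 ≤ q) {β h : ℝ}
    (hβ : 0 < β) (hh : 0 ≤ h) {m : Fin q → ℝ} (hm : maximizers p q β h = {m}) :
    ∃ s ∈ Set.Ico (0 : ℝ) 1, m = xvec q s := by
  have hmm : m ∈ maximizers p q β h := by rw [hm]; rfl
  have hq2 : (2 : ℝ) ≤ q := by exact_mod_cast hq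
  set i : Fin q := ⟨1, by omega⟩ with hi
  have hi0 : i ≠ 0 := by
    intro h
    have := congrArg Fin.val h
    simp [hi] at this
  have hconst : ∀ r, r ≠ 0 → m r = m i := by
    intro r hr
    -- Swapping two colours other than `0` leaves the field term unchanged.
    have := comp_perm_eq_of_maximizers_eq hm (Equiv.swap r i)
      (by rw [Equiv.swap_apply_of_ne_of_ne hr.symm hi0.symm]; simp)
    have := congrFun this i
    simpa using this
  have hle : m i ≤ m 0 := by
    by_contra! hlt
    -- As `h ≥ 0`, moving the larger entry to colour `0` cannot lower the energy, so uniqueness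
    -- forces the two entries to agree.
    have := comp_perm_eq_of_maximizers_eq hm (Equiv.swap 0 i)
      (by rw [Equiv.swap_apply_left]; exact mul_nonneg hh (by linarith))
    have := congrFun this i
    simp at this
    linarith
  have hsum : m 0 + ((q : ℝ) - 1) * m i = 1 := by
    rw [← sum_eq_zero_add_const m _ hconst]
    exact hmm.1.2
  have hx : m = xvec q (1 - q * m i) := by
    funext r
    by_cases hr : r = 0
    · rw [hr, xvec_zero]
      field_simp
      linear_combination (q : ℝ) * hsum
    · rw [xvec_of_ne _ hr, hconst r hr]
      field_simp
      ring
  refine ⟨1 - q * m i, ⟨by nlinarith, ?_⟩, hx⟩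
  have hi_nonneg : 0 ≤ m i := hmm.1.1 i
  rcases hi_nonneg.eq_or_lt with h0 | h0
  · exfalso
    rw [← h0] at hx
    simp only [mul_zero, sub_zero] at hx
    exact xvec_one_notMem_maximizers hp hq hβ hh (hx ▸ hmm)
  · have : 0 < (q : ℝ) * m i := by positivity
    linarith

/-! ### Taylor expansion and the derivatives of `k` and `f`. -/

/-- Second order Taylor expansion with the Peano remainder. -/
theorem isLittleO_taylor_two {f f' : ℝ → ℝ} {f'' a : ℝ}
    (hf : ∀ᶠ x in 𝓝 a, HasDerivAt f (f' x) x) (hf' : HasDerivAt f' f'' a) :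
    (fun y => f (a + y) - f a - f' a * y - f'' / 2 * y ^ 2) =o[𝓝 0] fun y => y ^ 2 := by
  rw [Asymptotics.isLittleO_iff]
  intro ε hε
  have h1 := hasDerivAt_iff_isLittleO_nhds_zero.1 hf'
  rw [Asymptotics.isLittleO_iff] at h1
  have h2 : ∀ᶠ y in 𝓝 (0 : ℝ), HasDerivAt f (f' (a + y)) (a + y) := by
    have : Tendsto (fun y : ℝ => a + y) (𝓝 0) (𝓝 a) := by
      simpa using (continuous_const_add a).tendsto (0 : ℝ)
    exact this.eventually hf
  obtain ⟨δ, hδ, hball⟩ := Metric.eventually_nhds_iff.1 ((h1 hε).and h2)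
  refine Metric.eventually_nhds_iff.2 ⟨δ, hδ, fun y hy => ?_⟩
  have hy' : |y| < δ := by simpa using hy
  have hsmall : ∀ z ∈ Set.uIcc (0 : ℝ) y, |z| ≤ |y| := fun z hz => by
    have := Set.abs_sub_left_of_mem_uIcc hz
    simpa using this
  -- Mean value inequality on the segment from `0` to `y`: differentiability of `f'` at `a` bounds
  -- the derivative of the remainder by `ε |y|` there.
  have key := (convex_uIcc (0 : ℝ) y).norm_image_sub_le_of_norm_hasDerivWithin_le
    (f := fun y => f (a + y) - f a - f' a * y - f'' / 2 * y ^ 2)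
    (f' := fun z => f' (a + z) - f' a - z * f'') (C := ε * |y|) (x := 0) (y := y)
    (fun z hz => ?_) (fun z hz => ?_) Set.left_mem_uIcc Set.right_mem_uIcc
  · simp only [add_zero, sub_self, mul_zero, zero_sub, sub_zero, Real.norm_eq_abs] at key ⊢
    rw [show ε * |y ^ 2| = ε * |y| * |y| by rw [abs_pow]; ring]
    simpa using key
  · have hz' : dist z 0 < δ := by simpa using (hsmall z hz).trans_lt hy'
    have hd := (hball hz').2
    have hd' : HasDerivAt (fun y => f (a + y)) (f' (a + z)) z := by
      simpa using hd.comp_const_add a z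
    have := ((hd'.sub_const (f a)).sub ((hasDerivAt_id z).const_mul (f' a))).sub
      (((hasDerivAt_id z).pow 2).const_mul (f'' / 2))
    convert! this.hasDerivWithinAt using 1
    simp
    ring
  · have hz' : dist z 0 < δ := by simpa using (hsmall z hz).trans_lt hy'
    have := (hball hz').1
    simp only [smul_eq_mul, Real.norm_eq_abs] at this ⊢
    exact this.trans (mul_le_mul_of_nonneg_left (hsmall z hz) hε.le)

theorem iteratedDeriv_two_eq {f f' : ℝ → ℝ} {f'' a : ℝ}
    (hf : ∀ᶠ x in 𝓝 a, HasDerivAt f (f' x) x) (hf' : HasDerivAt f' f'' a) :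
    iteratedDeriv 2 f a = f'' := by
  rw [iteratedDeriv_succ, iteratedDeriv_one]
  have : deriv f =ᶠ[𝓝 a] f' := hf.mono fun x hx => hx.deriv
  rw [this.deriv_eq, hf'.deriv]

/-- The first derivative of `k`. -/
def kFun' (p : ℕ) (β x : ℝ) : ℝ := β * (p * x ^ (p - 1)) - (Real.log x + 1)

/-- The second derivative of `k`. -/
def kFun'' (p : ℕ) (β x : ℝ) : ℝ := β * p * ((p : ℝ) - 1) * x ^ (p - 2) - 1 / x

theorem hasDerivAt_kFun (p : ℕ) (β : ℝ) {x : ℝ} (hx : 0 < x) :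
    HasDerivAt (kFun p β) (kFun' p β x) x :=
  ((hasDerivAt_pow p x).const_mul β).sub (Real.hasDerivAt_mul_log hx.ne')

theorem hasDerivAt_kFun' {p : ℕ} (hp : 2 ≤ p) (β : ℝ) {x : ℝ} (hx : 0 < x) :
    HasDerivAt (kFun' p β) (kFun'' p β x) x := by
  have h := (((hasDerivAt_pow (p - 1) x).const_mul (p : ℝ)).const_mul β).sub
    ((Real.hasDerivAt_log hx.ne').add_const 1)
  convert! h using 1
  rw [kFun'', Nat.cast_sub (by omega), show p - 1 - 1 = p - 2 by omega, one_div]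
  push_cast
  ring

theorem eventually_hasDerivAt_kFun (p : ℕ) (β : ℝ) {x : ℝ} (hx : 0 < x) :
    ∀ᶠ y in 𝓝 x, HasDerivAt (kFun p β) (kFun' p β y) y :=
  (lt_mem_nhds hx).mono fun _ hy => hasDerivAt_kFun p β hy

theorem iteratedDeriv_two_kFun {p : ℕ} (hp : 2 ≤ p) (β : ℝ) {x : ℝ} (hx : 0 < x) :
    iteratedDeriv 2 (kFun p β) x = kFun'' p β x :=
  iteratedDeriv_two_eq (eventually_hasDerivAt_kFun p β hx) (hasDerivAt_kFun' hp β hx)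

theorem quadForm_eq (p : ℕ) {q : ℕ} (β : ℝ) (s t : Fin q → ℝ) :
    quadForm p β s t = ∑ r, kFun'' p β (s r) * t r ^ 2 := rfl

theorem negFreeEnergy_eq (p : ℕ) {q : ℕ} [NeZero q] (β h : ℝ) (t : Fin q → ℝ) :
    negFreeEnergy p β h t = ∑ r, kFun p β (t r) + h * t 0 := by
  simp only [negFreeEnergy, kFun, Finset.sum_sub_distrib, Finset.mul_sum]
  ring

theorem hasDerivAt_fFun {p q : ℕ} [NeZero q] (β h : ℝ) {s : ℝ}
    (h0 : 0 < (1 + ((q : ℝ) - 1) * s) / q) (h1 : 0 < (1 - s) / q) :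
    HasDerivAt (fFun p q β h) (((q : ℝ) - 1) / q * (kFun' p β ((1 + ((q : ℝ) - 1) * s) / q) -
      kFun' p β ((1 - s) / q) + h)) s := by
  have e0 : HasDerivAt (fun s : ℝ => (1 + ((q : ℝ) - 1) * s) / q) (((q : ℝ) - 1) / q) s := by
    simpa using ((((hasDerivAt_id s).const_mul ((q : ℝ) - 1)).const_add 1).div_const (q : ℝ))
  have e1 : HasDerivAt (fun s : ℝ => (1 - s) / q) (-1 / q) s :=
    (((hasDerivAt_id s).const_sub 1).div_const (q : ℝ))
  have := (((hasDerivAt_kFun p β h0).comp s e0).add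
    (((hasDerivAt_kFun p β h1).comp s e1).const_mul ((q : ℝ) - 1))).add (e0.const_mul h)
  have hf : fFun p q β h = fun s => kFun p β ((1 + ((q : ℝ) - 1) * s) / q) +
      ((q : ℝ) - 1) * kFun p β ((1 - s) / q) + h * ((1 + ((q : ℝ) - 1) * s) / q) :=
    funext fun s => negFreeEnergy_xvec p q β h s
  rw [hf]
  convert! this using 1
  ring

theorem eventually_coords_pos {q : ℕ} [NeZero q] {s : ℝ} (hs : s ∈ Set.Ico (0 : ℝ) 1) :
    ∀ᶠ u in 𝓝 s, 0 < (1 + ((q : ℝ) - 1) * u) / q ∧ 0 < (1 - u) / (q : ℝ) := by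
  have hq0 : (0 : ℝ) < q := by exact_mod_cast (NeZero.pos q)
  have hq : (1 : ℝ) ≤ q := by exact_mod_cast (NeZero.one_le : 1 ≤ q)
  have h1 : 0 < 1 + ((q : ℝ) - 1) * s := by
    have := mul_nonneg (sub_nonneg.2 hq) hs.1
    linarith
  have h2 : 0 < 1 - s := by linarith [hs.2]
  have c1 : ContinuousAt (fun u : ℝ => 1 + ((q : ℝ) - 1) * u) s := by fun_prop
  have c2 : ContinuousAt (fun u : ℝ => 1 - u) s := by fun_prop
  filter_upwards [c1.eventually (lt_mem_nhds h1), c2.eventually (lt_mem_nhds h2)] with u a b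
  exact ⟨div_pos a hq0, div_pos b hq0⟩

/-- Consequently the scalar inverted in `Σ` is `-((q - 1) k''(x₀) + k''(x₁))`, where `x₀` and `x₁`
are the two values taken by `x_s`. -/
theorem iteratedDeriv_two_fFun {p q : ℕ} [NeZero q] (hp : 2 ≤ p) (β h : ℝ) {s : ℝ}
    (hs : s ∈ Set.Ico (0 : ℝ) 1) :
    iteratedDeriv 2 (fFun p q β h) s = ((q : ℝ) - 1) / (q : ℝ) ^ 2 *
      (((q : ℝ) - 1) * kFun'' p β ((1 + ((q : ℝ) - 1) * s) / q) +
        kFun'' p β ((1 - s) / q)) := by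
  refine iteratedDeriv_two_eq
    ((eventually_coords_pos hs).mono fun u hu => hasDerivAt_fFun β h hu.1 hu.2) ?_
  obtain ⟨h0, h1⟩ := (eventually_coords_pos (q := q) hs).self_of_nhds
  have e0 : HasDerivAt (fun s : ℝ => (1 + ((q : ℝ) - 1) * s) / q) (((q : ℝ) - 1) / q) s := by
    simpa using ((((hasDerivAt_id s).const_mul ((q : ℝ) - 1)).const_add 1).div_const (q : ℝ))
  have e1 : HasDerivAt (fun s : ℝ => (1 - s) / q) (-1 / q) s :=
    (((hasDerivAt_id s).const_sub 1).div_const (q : ℝ))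
  have := ((((hasDerivAt_kFun' hp β h0).comp s e0).sub
    ((hasDerivAt_kFun' hp β h1).comp s e1)).add_const h).const_mul (((q : ℝ) - 1) / q)
  convert! this using 1
  have hq0 : (q : ℝ) ≠ 0 := NeZero.ne _
  field_simp
  ring

/-! ### Critical point equations and quadratic decay of the energy. -/

/-- The Lagrange multiplier equations at a maximizer `x_s`. -/
theorem exists_multiplier {p q : ℕ} [NeZero q] (hq : 2 ≤ q) {β h s : ℝ}
    (hs : s ∈ Set.Ico (0 : ℝ) 1) (hm : xvec q s ∈ maximizers p q β h) :
    ∃ c : ℝ, ∀ r, kFun' p β (xvec q s r) + h * (if r = 0 then 1 else 0) = c := by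
  have hq2 : (2 : ℝ) ≤ q := by exact_mod_cast hq
  obtain ⟨h0, h1⟩ := (eventually_coords_pos (q := q) hs).self_of_nhds
  -- All entries of `x_s` are positive, so `x_u` stays in the simplex for `u` on both sides of `s`,
  -- even when `s = 0`.
  have hloc : IsLocalMax (fFun p q β h) s := by
    filter_upwards [eventually_coords_pos (q := q) hs] with u hu
    refine hm.2 ⟨fun r => ?_, sum_xvec q u⟩
    unfold xvec
    split_ifs
    exacts [hu.1.le, hu.2.le]
  have hz := hloc.hasDerivAt_eq_zero (hasDerivAt_fFun β h h0 h1)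
  have hne : ((q : ℝ) - 1) / q ≠ 0 := by
    have : 0 < ((q : ℝ) - 1) / q := div_pos (by linarith) (by linarith)
    exact this.ne'
  have hz' := (mul_eq_zero.1 hz).resolve_left hne
  refine ⟨kFun' p β ((1 - s) / q), fun r => ?_⟩
  by_cases hr : r = 0
  · simp only [hr, xvec_zero, if_true]
    linarith
  · simp [xvec_of_ne s hr, hr]

/-- The remainder of the second order Taylor expansion of `k` at `a`. -/
def kRem (p : ℕ) (β a y : ℝ) : ℝ :=
  kFun p β (a + y) - kFun p β a - kFun' p β a * y - kFun'' p β a / 2 * y ^ 2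

theorem isLittleO_kRem {p : ℕ} (hp : 2 ≤ p) (β : ℝ) {a : ℝ} (ha : 0 < a) :
    kRem p β a =o[𝓝 0] fun y => y ^ 2 :=
  isLittleO_taylor_two (eventually_hasDerivAt_kFun p β ha) (hasDerivAt_kFun' hp β ha)

/-- The Lagrange multiplier equations for `H_{β,h}` on the hyperplane `∑ r, t r = 1`. -/
def IsCritical (p : ℕ) {q : ℕ} [NeZero q] (β h : ℝ) (m : Fin q → ℝ) : Prop :=
  ∃ c : ℝ, ∀ r, kFun' p β (m r) + h * (if r = 0 then 1 else 0) = c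

/-- The gradient at a critical point is a constant vector, which pairs to zero with the sum-zero
vector `x - m`; the identity is exact because the remainder is kept. -/
theorem negFreeEnergy_sub_eq {p q : ℕ} [NeZero q] {β h : ℝ} {m : Fin q → ℝ}
    (hc : IsCritical p β h m) {x : Fin q → ℝ} (hx : ∑ r, (x r - m r) = 0) :
    negFreeEnergy p β h x - negFreeEnergy p β h m =
      quadForm p β m (fun r => x r - m r) / 2 + ∑ r, kRem p β (m r) (x r - m r) := by
  obtain ⟨c, hc⟩ := hc
  have h1 : ∑ r, (kFun' p β (m r) + h * (if r = 0 then 1 else 0)) * (x r - m r) = 0 := by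
    simp_rw [hc, ← Finset.mul_sum, hx, mul_zero]
  have h2 : ∑ r, h * (if r = 0 then (1 : ℝ) else 0) * (x r - m r) = h * (x 0 - m 0) := by
    simp
  simp only [add_mul, Finset.sum_add_distrib, h2] at h1
  simp only [negFreeEnergy_eq, quadForm_eq, kRem, Finset.sum_sub_distrib, add_sub_cancel,
    Finset.sum_div]
  have h3 : ∑ r, kFun'' p β (m r) / 2 * (x r - m r) ^ 2 =
      ∑ r, kFun'' p β (m r) * (x r - m r) ^ 2 / 2 :=
    Finset.sum_congr rfl fun r _ => by ring
  rw [h3]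
  linear_combination h1

theorem continuous_quadForm (p : ℕ) {q : ℕ} (β : ℝ) (m : Fin q → ℝ) :
    Continuous (quadForm p β m) := by
  unfold quadForm
  fun_prop

theorem continuous_negFreeEnergy (p : ℕ) {q : ℕ} [NeZero q] (β h : ℝ) :
    Continuous (negFreeEnergy p β h : (Fin q → ℝ) → ℝ) := by
  unfold negFreeEnergy
  have : ∀ r : Fin q, Continuous fun t : Fin q → ℝ => t r * Real.log (t r) := fun r =>
    Real.continuous_mul_log.comp (continuous_apply r)
  fun_prop

/-- Compactness of the unit sphere of the hyperplane, then homogeneity of degree two. -/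
theorem exists_quadForm_le {p q : ℕ} {β : ℝ} {m : Fin q → ℝ}
    (hneg : ∀ t : Fin q → ℝ, ∑ r, t r = 0 → t ≠ 0 → quadForm p β m t < 0) :
    ∃ c > 0, ∀ t : Fin q → ℝ, ∑ r, t r = 0 → quadForm p β m t ≤ -c * ∑ r, t r ^ 2 := by
  set S : Set (Fin q → ℝ) := {t | ∑ r, t r = 0 ∧ ∑ r, t r ^ 2 = 1} with hS
  have hclosed : IsClosed S :=
    (isClosed_eq (by fun_prop) continuous_const).inter
      (isClosed_eq (f := fun t : Fin q → ℝ => ∑ r, t r ^ 2) (by fun_prop) continuous_const)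
  have hbdd : S ⊆ Set.Icc (fun _ => -1) (fun _ => 1) := by
    intro t ht
    have : ∀ r, |t r| ≤ 1 := fun r => by
      rw [← sq_le_one_iff_abs_le_one, ← ht.2]
      exact Finset.single_le_sum (f := fun r => t r ^ 2) (fun i _ => sq_nonneg _)
        (Finset.mem_univ r)
    exact ⟨fun r => (abs_le.1 (this r)).1, fun r => (abs_le.1 (this r)).2⟩
  have hcomp : IsCompact S := isCompact_Icc.of_isClosed_subset hclosed hbdd
  obtain ⟨c, hc, hcS⟩ : ∃ c > 0, ∀ t ∈ S, quadForm p β m t ≤ -c := by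
    rcases S.eq_empty_or_nonempty with he | hne
    · exact ⟨1, one_pos, fun t ht => by simp [he] at ht⟩
    · obtain ⟨t₀, ht₀, hmax⟩ := hcomp.exists_isMaxOn hne (continuous_quadForm p β m).continuousOn
      refine ⟨-quadForm p β m t₀, ?_, fun t ht => by simpa using hmax ht⟩
      have : t₀ ≠ 0 := by
        rintro rfl
        simpa using ht₀.2
      linarith [hneg t₀ ht₀.1 this]
  refine ⟨c, hc, fun t ht => ?_⟩
  by_cases h0 : t = 0
  · simp [h0, quadForm]
  set n : ℝ := ∑ r, t r ^ 2 with hn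
  have hnpos : 0 < n := by
    obtain ⟨r, hr⟩ := Function.ne_iff.1 h0
    exact Finset.sum_pos' (fun i _ => sq_nonneg _) ⟨r, Finset.mem_univ r, by
      have : t r ≠ 0 := hr
      positivity⟩
  have hsq : (√n)⁻¹ ^ 2 = n⁻¹ := by rw [inv_pow, Real.sq_sqrt hnpos.le]
  have hmem : (fun r => (√n)⁻¹ * t r) ∈ S := by
    constructor
    · rw [← Finset.mul_sum, ht, mul_zero]
    · simp_rw [mul_pow, ← Finset.mul_sum, hsq, ← hn]
      exact inv_mul_cancel₀ hnpos.ne'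
  have := hcS _ hmem
  have hscale : quadForm p β m (fun r => (√n)⁻¹ * t r) = n⁻¹ * quadForm p β m t := by
    simp only [quadForm, mul_pow, hsq, Finset.mul_sum]
    exact Finset.sum_congr rfl fun r _ => by ring
  rw [hscale, inv_mul_le_iff₀ hnpos] at this
  linarith

/-- At a regular point `H_{β,h}` decays at least quadratically away from its maximizer. -/
theorem exists_negFreeEnergy_sub_le {p q : ℕ} [NeZero q] (hp : 2 ≤ p) {β h : ℝ} {m : Fin q → ℝ}
    (hpos : ∀ r, 0 < m r) (hc : IsCritical p β h m) (hm : maximizers p q β h = {m})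
    (hneg : ∀ t : Fin q → ℝ, ∑ r, t r = 0 → t ≠ 0 → quadForm p β m t < 0) :
    ∃ c > 0, ∀ x ∈ stdSimplex ℝ (Fin q),
      negFreeEnergy p β h x - negFreeEnergy p β h m ≤ -c * ∑ r, (x r - m r) ^ 2 := by
  have hmm : m ∈ maximizers p q β h := by rw [hm]; rfl
  obtain ⟨c₀, hc₀, hquad⟩ := exists_quadForm_le hneg
  have hrem : ∀ᶠ y in 𝓝 (0 : ℝ), ∀ r, |kRem p β (m r) y| ≤ c₀ / 4 * y ^ 2 := by
    rw [eventually_all]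
    intro r
    have := (Asymptotics.isLittleO_iff.1 (isLittleO_kRem hp β (hpos r)))
      (show 0 < c₀ / 4 by positivity)
    simpa using this
  obtain ⟨δ, hδ, hball⟩ := Metric.eventually_nhds_iff.1 hrem
  set F : Set (Fin q → ℝ) := stdSimplex ℝ (Fin q) ∩ ⋃ r, {x | δ ≤ |x r - m r|} with hF
  have hFc : IsCompact F := by
    refine (isCompact_stdSimplex ℝ (Fin q)).inter_right (isClosed_iUnion_of_finite fun r => ?_)
    exact isClosed_le continuous_const (by fun_prop)
  -- Outside a neighbourhood of `m` the gap comes from compactness and uniqueness of the maximizer.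
  obtain ⟨η, hη, hfar⟩ : ∃ η > 0, ∀ x ∈ F,
      negFreeEnergy p β h x - negFreeEnergy p β h m ≤ -η := by
    rcases F.eq_empty_or_nonempty with he | hne
    · exact ⟨1, one_pos, fun t ht => by simp [he] at ht⟩
    · obtain ⟨x₀, hx₀, hmax⟩ :=
        hFc.exists_isMaxOn hne (continuous_negFreeEnergy p β h).continuousOn
      refine ⟨negFreeEnergy p β h m - negFreeEnergy p β h x₀, ?_, fun x hx => ?_⟩
      · by_contra! hle
        have : x₀ ∈ maximizers p q β h := ⟨hx₀.1, fun y hy => by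
          have h1 := hmm.2 hy
          simp only [Set.mem_ofPred_eq] at h1 ⊢
          linarith⟩
        rw [hm] at this
        obtain ⟨r, hr⟩ := Set.mem_iUnion.1 hx₀.2
        have hxm : x₀ = m := this
        simp [hxm] at hr
        linarith
      · have h1 := hmax hx
        simp only [Set.mem_ofPred_eq] at h1
        linarith
  have hq : (0 : ℝ) < q := by exact_mod_cast (NeZero.pos q)
  -- Near `m` the form contributes `-c₀ / 2` and the remainder at most `c₀ / 4`. Far from `m` the
  -- squared distance is at most `q`, so the gap `η` suffices.
  refine ⟨min (c₀ / 4) (η / q), by positivity, fun x hx => ?_⟩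
  have hS : 0 ≤ ∑ r, (x r - m r) ^ 2 := Finset.sum_nonneg fun r _ => sq_nonneg _
  by_cases hxF : x ∈ F
  · have h1 : ∑ r, (x r - m r) ^ 2 ≤ q := by
      have : ∀ r ∈ Finset.univ, (x r - m r) ^ 2 ≤ 1 := fun r _ => by
        rw [sq_le_one_iff_abs_le_one, abs_le]
        have a1 := hx.1 r
        have a2 := hmm.1.1 r
        have a3 : x r ≤ 1 := hx.2 ▸ Finset.single_le_sum (fun i _ => hx.1 i) (Finset.mem_univ r)
        have a4 : m r ≤ 1 :=
          hmm.1.2 ▸ Finset.single_le_sum (fun i _ => hmm.1.1 i) (Finset.mem_univ r)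
        constructor <;> linarith
      simpa using Finset.sum_le_sum this
    have h2 := hfar x hxF
    have h3 : min (c₀ / 4) (η / q) * ∑ r, (x r - m r) ^ 2 ≤ η / q * q :=
      mul_le_mul (min_le_right _ _) h1 hS (by positivity)
    rw [div_mul_cancel₀ _ hq.ne'] at h3
    linarith
  · have hnear : ∀ r, |x r - m r| < δ := by
      intro r
      by_contra! hle
      exact hxF ⟨hx, Set.mem_iUnion.2 ⟨r, hle⟩⟩
    have hsum : ∑ r, (x r - m r) = 0 := by
      rw [Finset.sum_sub_distrib, hx.2, hmm.1.2, sub_self]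
    rw [negFreeEnergy_sub_eq hc hsum]
    have h1 := hquad _ hsum
    have h2 : ∑ r, kRem p β (m r) (x r - m r) ≤ c₀ / 4 * ∑ r, (x r - m r) ^ 2 := by
      rw [Finset.mul_sum]
      refine Finset.sum_le_sum fun r _ => ?_
      exact (le_abs_self _).trans (hball (by simpa using hnear r) r)
    have h3 : min (c₀ / 4) (η / q) * ∑ r, (x r - m r) ^ 2 ≤ c₀ / 4 * ∑ r, (x r - m r) ^ 2 :=
      mul_le_mul_of_nonneg_right (min_le_left _ _) hS
    linarith

/-! ### Limits of the energy on the scale `N ^ (-1/2)`. -/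

theorem tendsto_sub_of_tendsto_sqrt_mul {x : ℕ → ℝ} {a u : ℝ}
    (hx : Tendsto (fun N : ℕ => √(N : ℝ) * (x N - a)) atTop (𝓝 u)) :
    Tendsto (fun N => x N - a) atTop (𝓝 0) := by
  have h1 : Tendsto (fun N : ℕ => (√(N : ℝ))⁻¹) atTop (𝓝 0) :=
    tendsto_inv_atTop_zero.comp (Real.tendsto_sqrt_atTop.comp tendsto_natCast_atTop_atTop)
  have h2 := h1.mul hx
  rw [zero_mul] at h2
  refine h2.congr' ?_
  filter_upwards [eventually_gt_atTop 0] with N hN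
  have : √(N : ℝ) ≠ 0 := by positivity
  field_simp

/-- The delta method in dimension one. -/
theorem tendsto_sqrt_mul_sub_of_hasDerivAt {f : ℝ → ℝ} {f' a u : ℝ} (hf : HasDerivAt f f' a)
    {x : ℕ → ℝ} (hx : Tendsto (fun N : ℕ => √(N : ℝ) * (x N - a)) atTop (𝓝 u)) :
    Tendsto (fun N : ℕ => √(N : ℝ) * (f (x N) - f a)) atTop (𝓝 (f' * u)) := by
  have h0 := tendsto_sub_of_tendsto_sqrt_mul hx
  have h1 := (hasDerivAt_iff_isLittleO_nhds_zero.1 hf).comp_tendsto h0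
  have h2 := (Asymptotics.isBigO_refl (fun N : ℕ => √(N : ℝ)) atTop).mul_isLittleO h1
  have h3 : (fun N : ℕ => √(N : ℝ) * (x N - a)) =O[atTop] fun _ => (1 : ℝ) :=
    hx.isBigO_one ℝ
  have h4 := (Asymptotics.isLittleO_one_iff ℝ).1 (h2.trans_isBigO h3)
  have h5 := h4.add (hx.const_mul f')
  rw [zero_add] at h5
  refine h5.congr fun N => ?_
  simp only [Function.comp, smul_eq_mul, add_sub_cancel]
  ring

theorem tendsto_mul_kRem {p : ℕ} (hp : 2 ≤ p) (β : ℝ) {a u : ℝ} (ha : 0 < a) {x : ℕ → ℝ}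
    (hx : Tendsto (fun N : ℕ => √(N : ℝ) * (x N - a)) atTop (𝓝 u)) :
    Tendsto (fun N : ℕ => (N : ℝ) * kRem p β a (x N - a)) atTop (𝓝 0) := by
  have h0 := tendsto_sub_of_tendsto_sqrt_mul hx
  have h1 := (isLittleO_kRem hp β ha).comp_tendsto h0
  have h2 := (Asymptotics.isBigO_refl (fun N : ℕ => (N : ℝ)) atTop).mul_isLittleO h1
  have h3 : (fun N : ℕ => (N : ℝ) * (x N - a) ^ 2) =O[atTop] fun _ => (1 : ℝ) := by
    have := (hx.pow 2).isBigO_one ℝ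
    refine this.congr_left fun N => ?_
    rw [mul_pow, Real.sq_sqrt (Nat.cast_nonneg N)]
  exact (Asymptotics.isLittleO_one_iff ℝ).1 (h2.trans_isBigO h3)

theorem tendsto_mul_negFreeEnergy_sub {p q : ℕ} [NeZero q] (hp : 2 ≤ p) {β h : ℝ}
    {m : Fin q → ℝ} (hpos : ∀ r, 0 < m r) (hc : IsCritical p β h m) {x : ℕ → Fin q → ℝ}
    {u : Fin q → ℝ} (hsum : ∀ᶠ N in atTop, ∑ r, (x N r - m r) = 0)
    (hx : ∀ r, Tendsto (fun N : ℕ => √(N : ℝ) * (x N r - m r)) atTop (𝓝 (u r))) :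
    Tendsto (fun N : ℕ => (N : ℝ) * (negFreeEnergy p β h (x N) - negFreeEnergy p β h m))
      atTop (𝓝 (quadForm p β m u / 2)) := by
  have h1 : Tendsto (fun N : ℕ => quadForm p β m (fun r => √(N : ℝ) * (x N r - m r)) / 2)
      atTop (𝓝 (quadForm p β m u / 2)) :=
    (((continuous_quadForm p β m).tendsto u).comp (tendsto_pi_nhds.2 hx)).div_const 2
  have h2 : Tendsto (fun N : ℕ => ∑ r, (N : ℝ) * kRem p β (m r) (x N r - m r)) atTop (𝓝 0) := by
    simpa using tendsto_finsetSum Finset.univ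
      fun r _ => tendsto_mul_kRem hp β (hpos r) (hx r)
  have h3 := h1.add h2
  rw [add_zero] at h3
  refine h3.congr' ?_
  filter_upwards [hsum] with N hN
  rw [negFreeEnergy_sub_eq hc hN, mul_add, Finset.mul_sum]
  congr 1
  simp only [quadForm, mul_pow, Real.sq_sqrt (Nat.cast_nonneg (α := ℝ) N), Finset.mul_sum,
    Finset.sum_div]
  exact Finset.sum_congr rfl fun r _ => by ring

/-- Since `N / √N = √N`, the perturbation acts on fluctuations at order one. The identity serves
both the pointwise limit and the uniform bound. -/
theorem mul_negFreeEnergy_perturbed_sub (p : ℕ) {q : ℕ} [NeZero q] (β h βbar hbar : ℝ)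
    (x m : Fin q → ℝ) (N : ℕ) :
    (N : ℝ) * (negFreeEnergy p (β + βbar / √(N : ℝ)) (h + hbar / √(N : ℝ)) x -
        negFreeEnergy p (β + βbar / √(N : ℝ)) (h + hbar / √(N : ℝ)) m) =
      N * (negFreeEnergy p β h x - negFreeEnergy p β h m) +
        (βbar * ∑ r, √(N : ℝ) * (x r ^ p - m r ^ p) + hbar * (√(N : ℝ) * (x 0 - m 0))) := by
  have h1 : (N : ℝ) / √(N : ℝ) = √(N : ℝ) := Real.div_sqrt
  rw [← Finset.mul_sum, Finset.sum_sub_distrib]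
  unfold negFreeEnergy
  linear_combination (βbar * (∑ r, x r ^ p - ∑ r, m r ^ p) + hbar * (x 0 - m 0)) * h1

/-- The delta method applied to `x ↦ x ^ p` produces the factor `p m ^ (p - 1)` of the drift. -/
theorem tendsto_mul_negFreeEnergy_perturbed_sub {p q : ℕ} [NeZero q] (hp : 2 ≤ p) {β h : ℝ}
    (βbar hbar : ℝ) {m : Fin q → ℝ} (hpos : ∀ r, 0 < m r) (hc : IsCritical p β h m)
    {x : ℕ → Fin q → ℝ} {u : Fin q → ℝ} (hsum : ∀ᶠ N in atTop, ∑ r, (x N r - m r) = 0)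
    (hx : ∀ r, Tendsto (fun N : ℕ => √(N : ℝ) * (x N r - m r)) atTop (𝓝 (u r))) :
    Tendsto (fun N : ℕ => (N : ℝ) *
        (negFreeEnergy p (β + βbar / √(N : ℝ)) (h + hbar / √(N : ℝ)) (x N) -
          negFreeEnergy p (β + βbar / √(N : ℝ)) (h + hbar / √(N : ℝ)) m))
      atTop (𝓝 (quadForm p β m u / 2 + ∑ r, driftVec p βbar hbar m r * u r)) := by
  have h1 := tendsto_mul_negFreeEnergy_sub hp hpos hc hsum hx
  have h2 : Tendsto (fun N : ℕ => ∑ r, √(N : ℝ) * (x N r ^ p - m r ^ p)) atTop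
      (𝓝 (∑ r, p * m r ^ (p - 1) * u r)) :=
    tendsto_finsetSum _ fun r _ =>
      tendsto_sqrt_mul_sub_of_hasDerivAt (hasDerivAt_pow p (m r)) (hx r)
  have h3 := h1.add ((h2.const_mul βbar).add ((hx 0).const_mul hbar))
  have h4 : ∑ r, driftVec p βbar hbar m r * u r =
      βbar * ∑ r, p * m r ^ (p - 1) * u r + hbar * u 0 := by
    simp only [driftVec, add_mul, Finset.sum_add_distrib, Finset.mul_sum]
    congr 1
    · exact Finset.sum_congr rfl fun r _ => by ring
    · simp
  rw [h4]
  exact h3.congr fun N => (mul_negFreeEnergy_perturbed_sub p β h βbar hbar (x N) m N).symm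

/-! ### Stirling's formula and the local density. -/

open Nat in
/-- The ratio of `n !` to its Stirling approximation without the constant `√(2π)`. -/
def stirlingRatio (n : ℕ) : ℝ :=
  (n ! : ℝ) / (√(max (n : ℝ) 1) * Real.exp (n * Real.log n - n))

open Nat in
theorem factorial_eq_stirlingRatio_mul (n : ℕ) :
    (n ! : ℝ) = stirlingRatio n * (√(max (n : ℝ) 1) * Real.exp (n * Real.log n - n)) := by
  have : 0 < max (n : ℝ) 1 := by positivity
  rw [stirlingRatio, div_mul_cancel₀]
  positivity

theorem stirlingRatio_eq {n : ℕ} (hn : n ≠ 0) :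
    stirlingRatio n = √2 * Stirling.stirlingSeq n := by
  have hn0 : (0 : ℝ) < n := by positivity
  have hn1 : (1 : ℝ) ≤ n := by exact_mod_cast Nat.one_le_iff_ne_zero.2 hn
  have he : Real.exp (n * Real.log n - n) = (n / Real.exp 1) ^ n := by
    rw [Real.exp_sub, mul_comm, Real.exp_mul, Real.exp_log hn0, Real.rpow_natCast, div_pow,
      ← Real.exp_nat_mul, mul_one]
  rw [stirlingRatio, Stirling.stirlingSeq, max_eq_left hn1, he, Real.sqrt_mul (by norm_num)]
  have : √(2 : ℝ) ≠ 0 := by positivity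
  have : √(n : ℝ) ≠ 0 := by positivity
  field_simp

theorem tendsto_stirlingRatio :
    Tendsto stirlingRatio atTop (𝓝 (√2 * √Real.pi)) :=
  (Stirling.tendsto_stirlingSeq_sqrt_pi.const_mul _).congr' <|
    (eventually_ne_atTop 0).mono fun _ hn => (stirlingRatio_eq hn).symm

/-- The `max` with `1` in the definition is there for colours that do not occur; with it the bounds
below need no positivity of the counts. -/
theorem stirlingRatio_zero : stirlingRatio 0 = 1 := by simp [stirlingRatio]

theorem one_le_stirlingRatio (n : ℕ) : 1 ≤ stirlingRatio n := by
  rcases eq_or_ne n 0 with rfl | hn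
  · rw [stirlingRatio_zero]
  · rw [stirlingRatio_eq hn]
    have h1 : 1 ≤ √(2 : ℝ) := Real.one_le_sqrt.2 (by norm_num)
    have h2 : 1 ≤ √Real.pi := Real.one_le_sqrt.2 (by linarith [Real.pi_gt_three])
    have h3 := Stirling.sqrt_pi_le_stirlingSeq hn
    nlinarith

theorem exists_stirlingRatio_le : ∃ b, ∀ n, stirlingRatio n ≤ b := by
  obtain ⟨b, hb⟩ := tendsto_stirlingRatio.bddAbove_range
  exact ⟨b, fun n => hb ⟨n, rfl⟩⟩

theorem stirlingRatio_pos (n : ℕ) : 0 < stirlingRatio n :=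
  one_pos.trans_le (one_le_stirlingRatio n)

/-- The rescaled fluctuation of a vector of colour counts. -/
def countFluct {q : ℕ} (m : Fin q → ℝ) (N : ℕ) (k : Fin q → ℕ) (r : Fin q) : ℝ :=
  √(N : ℝ) * ((k r : ℝ) / N - m r)

/-- The mass of a count vector in the perturbed model, relative to its formal value at `m`, and
rescaled so as to have a limit. -/
def localDensity (p : ℕ) {q : ℕ} [NeZero q] (β h βbar hbar : ℝ) (m : Fin q → ℝ) (N : ℕ)
    (k : Fin q → ℕ) : ℝ :=
  stirlingRatio N / (∏ r, stirlingRatio (k r)) * (∏ r, √((N : ℝ) / max (k r : ℝ) 1)) *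
    Real.exp (N * (negFreeEnergy p (β + βbar / √(N : ℝ)) (h + hbar / √(N : ℝ))
        (fun r => (k r : ℝ) / N) -
      negFreeEnergy p (β + βbar / √(N : ℝ)) (h + hbar / √(N : ℝ)) m))

theorem localDensity_nonneg (p : ℕ) {q : ℕ} [NeZero q] (β h βbar hbar : ℝ) (m : Fin q → ℝ)
    (N : ℕ) (k : Fin q → ℕ) : 0 ≤ localDensity p β h βbar hbar m N k := by
  have := stirlingRatio_pos N
  have := Finset.prod_pos fun r (_ : r ∈ Finset.univ) => stirlingRatio_pos (k r)
  unfold localDensity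
  positivity

/-- The limit of the prefactor of the local density. -/
def localConst {q : ℕ} (m : Fin q → ℝ) : ℝ :=
  √2 * √Real.pi / (∏ _r : Fin q, √2 * √Real.pi) * ∏ r, √(1 / m r)

theorem localConst_pos {q : ℕ} {m : Fin q → ℝ} (hm : ∀ r, 0 < m r) : 0 < localConst m := by
  have : 0 < √2 * √Real.pi := by positivity
  have := Finset.prod_pos fun r (_ : r ∈ Finset.univ) =>
    Real.sqrt_pos.2 (one_div_pos.2 (hm r))
  have := Finset.prod_pos fun (_ : Fin q) (_ : _ ∈ Finset.univ) => ‹0 < √2 * √Real.pi›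
  unfold localConst
  positivity

/-- Each `m r` is positive, so every count tends to infinity like `N * m r`. Hence all Stirling
ratios converge, and the exponent converges by the expansion of the energy. -/
theorem tendsto_localDensity {p q : ℕ} [NeZero q] (hp : 2 ≤ p) {β h : ℝ}
    (βbar hbar : ℝ) {m : Fin q → ℝ} (hpos : ∀ r, 0 < m r) (hm1 : ∑ r, m r = 1)
    (hc : IsCritical p β h m)
    {k : ℕ → Fin q → ℕ} {u : Fin q → ℝ} (hsum : ∀ᶠ N in atTop, ∑ r, k N r = N)
    (hk : ∀ r, Tendsto (fun N : ℕ => countFluct m N (k N) r) atTop (𝓝 (u r))) :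
    Tendsto (fun N => localDensity p β h βbar hbar m N (k N)) atTop
      (𝓝 (localConst m *
        Real.exp (quadForm p β m u / 2 + ∑ r, driftVec p βbar hbar m r * u r))) := by
  have hratio : ∀ r, Tendsto (fun N : ℕ => (k N r : ℝ) / N) atTop (𝓝 (m r)) := fun r => by
    simpa using (tendsto_sub_of_tendsto_sqrt_mul (hk r)).add_const (m r)
  have hkinf : ∀ r, Tendsto (fun N : ℕ => (k N r : ℝ)) atTop atTop := fun r => by
    refine ((hratio r).pos_mul_atTop (hpos r) tendsto_natCast_atTop_atTop).congr' ?_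
    filter_upwards [eventually_gt_atTop 0] with N hN
    have : (N : ℝ) ≠ 0 := by positivity
    field_simp
  have hkinf' : ∀ r, Tendsto (fun N : ℕ => k N r) atTop atTop := fun r =>
    tendsto_natCast_atTop_iff.1 (hkinf r)
  have h1 : Tendsto (fun N => stirlingRatio N / ∏ r, stirlingRatio (k N r)) atTop
      (𝓝 (√2 * √Real.pi / ∏ _r : Fin q, √2 * √Real.pi)) := by
    refine tendsto_stirlingRatio.div
      (tendsto_finsetProd _ fun r _ => tendsto_stirlingRatio.comp (hkinf' r)) ?_
    exact Finset.prod_ne_zero_iff.2 fun _ _ => by positivity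
  have h2 : Tendsto (fun N : ℕ => ∏ r, √((N : ℝ) / max (k N r : ℝ) 1)) atTop
      (𝓝 (∏ r, √(1 / m r))) := by
    refine tendsto_finsetProd _ fun r _ => (Real.continuous_sqrt.tendsto _).comp ?_
    have := (hratio r).inv₀ (hpos r).ne'
    rw [one_div]
    refine this.congr' ?_
    filter_upwards [(hkinf r).eventually_ge_atTop 1] with N hN
    rw [max_eq_left hN, inv_div]
  have h3 := tendsto_mul_negFreeEnergy_perturbed_sub hp βbar hbar hpos hc
    (x := fun N r => (k N r : ℝ) / N) (u := u) (by
      filter_upwards [hsum, eventually_gt_atTop 0] with N hN hN0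
      have : (N : ℝ) ≠ 0 := by positivity
      rw [Finset.sum_sub_distrib, hm1, ← Finset.sum_div, ← Nat.cast_sum, hN, div_self this,
        sub_self]) hk
  exact (h1.mul h2).mul ((Real.continuous_exp.tendsto _).comp h3)

/-! ### Uniform Gaussian bound on the local density. -/

/-- The prefactor is large only near a face of the simplex. There `k / N < a / 2`, so the
fluctuation `u` satisfies `u ^ 2 ≥ N a ^ 2 / 4`; thus the prefactor is paid for by a power of `u`,
hence by `exp |u|`. -/
theorem sqrt_div_max_le {a : ℝ} (ha : 0 < a) (N k : ℕ) (hN : 0 < N) :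
    √((N : ℝ) / max (k : ℝ) 1) ≤
      √(2 / a + 4 / a ^ 2) * Real.exp |√(N : ℝ) * ((k : ℝ) / N - a)| := by
  set u : ℝ := √(N : ℝ) * ((k : ℝ) / N - a) with hu
  have hN0 : (0 : ℝ) < N := by positivity
  have husq : u ^ 2 = N * ((k : ℝ) / N - a) ^ 2 := by
    rw [hu, mul_pow, Real.sq_sqrt hN0.le]
  have hmax : (0 : ℝ) < max (k : ℝ) 1 := by positivity
  have hexp : 1 + u ^ 2 ≤ Real.exp |u| ^ 2 := by
    have h1 := Real.quadratic_le_exp_of_nonneg (abs_nonneg u)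
    have h3 : (1 + |u| + |u| ^ 2 / 2) ^ 2 ≤ Real.exp |u| ^ 2 :=
      pow_le_pow_left₀ (by positivity) h1 2
    rw [← sq_abs u]
    have := abs_nonneg u
    nlinarith [pow_nonneg this 3, pow_nonneg this 4]
  have hmain : (N : ℝ) / max (k : ℝ) 1 ≤ (2 / a + 4 / a ^ 2) * (1 + u ^ 2) := by
    have hA : 0 < 2 / a := by positivity
    have hB : 0 < 4 / a ^ 2 := by positivity
    by_cases hk : a / 2 ≤ (k : ℝ) / N
    · have h1 : (N : ℝ) / max (k : ℝ) 1 ≤ 2 / a := by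
        rw [div_le_div_iff₀ hmax ha]
        rw [div_le_div_iff₀ two_pos hN0] at hk
        nlinarith [le_max_left (k : ℝ) 1]
      nlinarith [mul_nonneg (add_pos hA hB).le (sq_nonneg u)]
    · have h1 : a ^ 2 / 4 ≤ ((k : ℝ) / N - a) ^ 2 := by nlinarith
      have h2 : (N : ℝ) ≤ 4 / a ^ 2 * u ^ 2 := by
        rw [husq]
        have := mul_le_mul_of_nonneg_left h1 (show 0 ≤ 4 / a ^ 2 * N by positivity)
        have e : 4 / a ^ 2 * N * (a ^ 2 / 4) = N := by field_simp
        rw [e] at this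
        linarith
      have h3 : (N : ℝ) / max (k : ℝ) 1 ≤ N := div_le_self hN0.le (le_max_right _ _)
      nlinarith [mul_nonneg hA.le (sq_nonneg u)]
  calc √((N : ℝ) / max (k : ℝ) 1)
      ≤ √((2 / a + 4 / a ^ 2) * Real.exp |u| ^ 2) :=
        Real.sqrt_le_sqrt (hmain.trans (mul_le_mul_of_nonneg_left hexp (by positivity)))
    _ = √(2 / a + 4 / a ^ 2) * Real.exp |u| := by
        rw [Real.sqrt_mul (by positivity), Real.sqrt_sq (Real.exp_pos _).le]

theorem abs_pow_sub_pow_le_mul (p : ℕ) {x y : ℝ} (hx : x ∈ Set.Icc (0 : ℝ) 1)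
    (hy : y ∈ Set.Icc (0 : ℝ) 1) : |x ^ p - y ^ p| ≤ p * |x - y| := by
  have := abs_pow_sub_pow_le x y p
  have h1 : max |x| |y| ≤ 1 := by
    rw [abs_of_nonneg hx.1, abs_of_nonneg hy.1]
    exact max_le hx.2 hy.2
  have h2 : max |x| |y| ^ (p - 1) ≤ 1 := pow_le_one₀ (by positivity) h1
  refine this.trans ?_
  have : 0 ≤ |x - y| * p := by positivity
  nlinarith

theorem mem_Icc_of_mem_stdSimplex {q : ℕ} {x : Fin q → ℝ} (hx : x ∈ stdSimplex ℝ (Fin q))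
    (r : Fin q) : x r ∈ Set.Icc (0 : ℝ) 1 :=
  ⟨hx.1 r, hx.2 ▸ Finset.single_le_sum (fun i _ => hx.1 i) (Finset.mem_univ r)⟩

/-- Linear exponential growth is absorbed by Gaussian decay. -/
theorem exp_mul_abs_sub_le {c : ℝ} (hc : 0 < c) (D y : ℝ) :
    D * |y| - c * y ^ 2 ≤ D ^ 2 / (2 * c) - c / 2 * y ^ 2 := by
  have : 0 ≤ (D / c - |y|) ^ 2 * (c / 2) := by positivity
  have e : (D / c - |y|) ^ 2 * (c / 2) = D ^ 2 / (2 * c) - D * |y| + c / 2 * |y| ^ 2 := by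
    field_simp
    ring
  rw [e, sq_abs] at this
  linarith

/-- The prefactor and the parameter perturbation cost only a factor exponential in `∑ |u r|`, which
half of the Gaussian decay absorbs. -/
theorem exists_localDensity_le {p q : ℕ} [NeZero q] {β h : ℝ} (βbar hbar : ℝ) {m : Fin q → ℝ}
    (hpos : ∀ r, 0 < m r) (hm1 : ∑ r, m r = 1)
    (hbound : ∃ c > 0, ∀ x ∈ stdSimplex ℝ (Fin q),
      negFreeEnergy p β h x - negFreeEnergy p β h m ≤ -c * ∑ r, (x r - m r) ^ 2) :
    ∃ C c : ℝ, 0 ≤ C ∧ 0 < c ∧ ∀ (N : ℕ) (k : Fin q → ℕ), 0 < N → ∑ r, k r = N →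
      localDensity p β h βbar hbar m N k ≤
        C * Real.exp (-c * ∑ r, countFluct m N k r ^ 2) := by
  obtain ⟨c, hc, hH⟩ := hbound
  obtain ⟨b, hb⟩ := exists_stirlingRatio_le
  have hb1 : 1 ≤ b := (one_le_stirlingRatio 0).trans (hb 0)
  -- The first two terms bound the perturbation, `x ↦ x ^ p` being `p`-Lipschitz on `[0, 1]`; the
  -- `1` pays for the prefactor.
  set D : ℝ := |βbar| * p + |hbar| + 1 with hD
  set A : ℝ := ∏ r, √(2 / m r + 4 / m r ^ 2) with hA
  have hA0 : 0 ≤ A := Finset.prod_nonneg fun r _ => Real.sqrt_nonneg _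
  refine ⟨b * A * Real.exp (∑ _r : Fin q, D ^ 2 / (2 * c)), c / 2, by positivity, by positivity,
    fun N k hN hk => ?_⟩
  have hN0 : (0 : ℝ) < N := by positivity
  set x : Fin q → ℝ := fun r => (k r : ℝ) / N with hx
  set u : Fin q → ℝ := countFluct m N k with hu
  have hur : ∀ r, u r = √(N : ℝ) * (x r - m r) := fun r => rfl
  have hxs : x ∈ stdSimplex ℝ (Fin q) := by
    refine ⟨fun r => by positivity, ?_⟩
    rw [hx, ← Finset.sum_div, ← Nat.cast_sum, hk, div_self hN0.ne']
  have hms : m ∈ stdSimplex ℝ (Fin q) := ⟨fun r => (hpos r).le, hm1⟩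
  have h1 : stirlingRatio N / (∏ r, stirlingRatio (k r)) ≤ b := by
    have : 1 ≤ ∏ r, stirlingRatio (k r) := Finset.one_le_prod fun r _ => one_le_stirlingRatio _
    exact (div_le_self (stirlingRatio_pos N).le this).trans (hb N)
  have h2 : ∏ r, √((N : ℝ) / max (k r : ℝ) 1) ≤ A * Real.exp (∑ r, |u r|) := by
    rw [Real.exp_sum, hA, ← Finset.prod_mul_distrib]
    exact Finset.prod_le_prod (fun r _ => Real.sqrt_nonneg _)
      fun r _ => sqrt_div_max_le (hpos r) N (k r) hN
  have h3 : (N : ℝ) * (negFreeEnergy p (β + βbar / √(N : ℝ)) (h + hbar / √(N : ℝ)) x -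
      negFreeEnergy p (β + βbar / √(N : ℝ)) (h + hbar / √(N : ℝ)) m) ≤
      -c * ∑ r, u r ^ 2 + (D - 1) * ∑ r, |u r| := by
    rw [mul_negFreeEnergy_perturbed_sub]
    have e1 : (N : ℝ) * (negFreeEnergy p β h x - negFreeEnergy p β h m) ≤
        -c * ∑ r, u r ^ 2 := by
      have := mul_le_mul_of_nonneg_left (hH x hxs) hN0.le
      refine this.trans (le_of_eq ?_)
      simp only [hur, mul_pow, Real.sq_sqrt hN0.le, ← Finset.mul_sum]
      ring
    have e2 : |∑ r, √(N : ℝ) * (x r ^ p - m r ^ p)| ≤ p * ∑ r, |u r| := by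
      rw [Finset.mul_sum]
      refine (Finset.abs_sum_le_sum_abs _ _).trans (Finset.sum_le_sum fun r _ => ?_)
      rw [hur, abs_mul, abs_mul, abs_of_nonneg (Real.sqrt_nonneg _)]
      have := mul_le_mul_of_nonneg_left (abs_pow_sub_pow_le_mul p
        (mem_Icc_of_mem_stdSimplex hxs r) (mem_Icc_of_mem_stdSimplex hms r))
        (Real.sqrt_nonneg (N : ℝ))
      linarith
    have e3 : |√(N : ℝ) * (x 0 - m 0)| ≤ ∑ r, |u r| :=
      Finset.single_le_sum (f := fun r => |u r|) (fun r _ => abs_nonneg _) (Finset.mem_univ 0)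
    have e4 : βbar * ∑ r, √(N : ℝ) * (x r ^ p - m r ^ p) ≤ |βbar| * (p * ∑ r, |u r|) := by
      refine (le_abs_self _).trans ?_
      rw [abs_mul]
      exact mul_le_mul_of_nonneg_left e2 (abs_nonneg _)
    have e5 : hbar * (√(N : ℝ) * (x 0 - m 0)) ≤ |hbar| * ∑ r, |u r| := by
      refine (le_abs_self _).trans ?_
      rw [abs_mul]
      exact mul_le_mul_of_nonneg_left e3 (abs_nonneg _)
    have e6 : (D - 1) * ∑ r, |u r| = |βbar| * (p * ∑ r, |u r|) + |hbar| * ∑ r, |u r| := by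
      rw [hD]; ring
    linarith
  have h4 : ∑ r, |u r| + (-c * ∑ r, u r ^ 2 + (D - 1) * ∑ r, |u r|) ≤
      ∑ _r : Fin q, D ^ 2 / (2 * c) + -(c / 2) * ∑ r, u r ^ 2 := by
    have := Finset.sum_le_sum fun r (_ : r ∈ Finset.univ) => exp_mul_abs_sub_le hc D (u r)
    rw [Finset.sum_sub_distrib, Finset.sum_sub_distrib, ← Finset.mul_sum, ← Finset.mul_sum,
      ← Finset.mul_sum] at this
    linarith
  have hP : 0 ≤ ∏ r, √((N : ℝ) / max (k r : ℝ) 1) :=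
    Finset.prod_nonneg fun r _ => Real.sqrt_nonneg _
  calc localDensity p β h βbar hbar m N k
      ≤ b * (A * Real.exp (∑ r, |u r|)) *
          Real.exp (-c * ∑ r, u r ^ 2 + (D - 1) * ∑ r, |u r|) := by
        unfold localDensity
        exact mul_le_mul (mul_le_mul h1 h2 hP (by linarith)) (Real.exp_le_exp.2 h3)
          (Real.exp_pos _).le (by positivity)
    _ = b * A * Real.exp (∑ r, |u r| + (-c * ∑ r, u r ^ 2 + (D - 1) * ∑ r, |u r|)) := by
        rw [Real.exp_add (∑ r, |u r|)]; ring
    _ ≤ b * A * Real.exp (∑ _r : Fin q, D ^ 2 / (2 * c) + -(c / 2) * ∑ r, u r ^ 2) :=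
        mul_le_mul_of_nonneg_left (Real.exp_le_exp.2 h4) (by positivity)
    _ = _ := by rw [Real.exp_add]; ring

/-! ### From configurations to colour counts. -/

/-- The number of sites of each colour. -/
def colourCount {N q : ℕ} (X : Fin N → Fin q) (r : Fin q) : ℕ :=
  Finset.card {i | X i = r}

theorem magnetization_eq {N q : ℕ} (X : Fin N → Fin q) (r : Fin q) :
    magnetization X r = (colourCount X r : ℝ) / N := by
  simp [magnetization, colourCount]

theorem monomial_equivFunOnFinite_symm {q : ℕ} (k : Fin q → ℕ) :
    MvPolynomial.monomial (Finsupp.equivFunOnFinite.symm k) (1 : ℝ) =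
      ∏ r, (MvPolynomial.X r : MvPolynomial (Fin q) ℝ) ^ k r := by
  rw [MvPolynomial.monomial_eq, map_one, one_mul, Finsupp.prod_fintype _ _ (by simp)]
  rfl

/-- The number of configurations with given colour counts is a multinomial coefficient. -/
theorem sum_comp_colourCount {N q : ℕ} (F : (Fin q → ℕ) → ℝ) :
    ∑ X : Fin N → Fin q, F (colourCount X) =
      ∑ k ∈ Finset.piAntidiag Finset.univ N, (Nat.multinomial Finset.univ k : ℝ) * F k := by
  -- The functional `L` replaces each monomial by the value of `F` at its exponent. Applied to two
  -- expansions of `(∑ X_r) ^ N`, over words and by the multinomial theorem, it gives the two sides.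
  set L : MvPolynomial (Fin q) ℝ →ₗ[ℝ] ℝ :=
    (MvPolynomial.basisMonomials (Fin q) ℝ).constr ℝ fun d => F d with hL
  have hmon : ∀ k : Fin q → ℕ,
      L (∏ r, (MvPolynomial.X r : MvPolynomial (Fin q) ℝ) ^ k r) = F k := by
    intro k
    rw [← monomial_equivFunOnFinite_symm, hL]
    simpa using (MvPolynomial.basisMonomials (Fin q) ℝ).constr_basis ℝ (fun d => F d)
      (Finsupp.equivFunOnFinite.symm k)
  have h1 : (∑ r, (MvPolynomial.X r : MvPolynomial (Fin q) ℝ)) ^ N =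
      ∑ X : Fin N → Fin q, ∏ r, MvPolynomial.X r ^ colourCount X r := by
    rw [Fintype.sum_pow]
    refine Finset.sum_congr rfl fun X _ => ?_
    rw [← Finset.prod_fiberwise Finset.univ X]
    refine Finset.prod_congr rfl fun r _ => ?_
    rw [colourCount, ← Finset.prod_const]
    exact Finset.prod_congr rfl fun i hi => by rw [(Finset.mem_filter.1 hi).2]
  have h2 := congrArg L (h1.symm.trans (Finset.sum_pow_eq_sum_piAntidiag Finset.univ _ N))
  rw [map_sum, map_sum] at h2
  simp only [hmon] at h2
  rw [h2]
  refine Finset.sum_congr rfl fun k _ => ?_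
  rw [← nsmul_eq_mul, map_nsmul, hmon, nsmul_eq_mul]

/-- Stirling's approximation of the mass of a count vector. -/
theorem multinomial_mul_exp_eq {p q : ℕ} [NeZero q] (β h βbar hbar : ℝ) (m : Fin q → ℝ) {N : ℕ}
    (hN : 0 < N) (k : Fin q → ℕ) (hk : ∑ r, k r = N) :
    (Nat.multinomial Finset.univ k : ℝ) * Real.exp ((β + βbar / √(N : ℝ)) * N *
        ∑ r, ((k r : ℝ) / N) ^ p + N * (h + hbar / √(N : ℝ)) * ((k 0 : ℝ) / N)) =
      localDensity p β h βbar hbar m N k *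
        (Real.exp (N * negFreeEnergy p (β + βbar / √(N : ℝ)) (h + hbar / √(N : ℝ)) m) *
          (√(N : ℝ) / √(N : ℝ) ^ q)) := by
  have hN0 : (0 : ℝ) < N := by positivity
  have hN1 : (1 : ℝ) ≤ N := by exact_mod_cast hN
  set b := β + βbar / √(N : ℝ) with hb
  set g := h + hbar / √(N : ℝ) with hg
  have hfac : (Nat.multinomial Finset.univ k : ℝ) * ∏ r, (Nat.factorial (k r) : ℝ) =
      Nat.factorial N := by
    have := Nat.multinomial_spec Finset.univ k
    rw [hk] at this
    rw [mul_comm]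
    exact_mod_cast this
  have hent : (N : ℝ) * Real.log N - N - ∑ r, ((k r : ℝ) * Real.log (k r) - k r) =
      -(N * ∑ r, (k r : ℝ) / N * Real.log ((k r : ℝ) / N)) := by
    have e1 : (N : ℝ) * ∑ r, (k r : ℝ) / N * Real.log ((k r : ℝ) / N) =
        ∑ r, ((k r : ℝ) * Real.log (k r) - k r * Real.log N) := by
      rw [Finset.mul_sum]
      refine Finset.sum_congr rfl fun r _ => ?_
      rcases eq_or_ne (k r) 0 with h0 | h0
      · simp [h0]
      · rw [Real.log_div (by exact_mod_cast h0) hN0.ne']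
        field_simp
    rw [e1, Finset.sum_sub_distrib, Finset.sum_sub_distrib, ← Finset.sum_mul, ← Nat.cast_sum, hk]
    ring
  simp only [factorial_eq_stirlingRatio_mul, Finset.prod_mul_distrib, ← Real.exp_sum,
    max_eq_left hN1] at hfac
  have hpr : ∏ r, √((N : ℝ) / max (k r : ℝ) 1) =
      √(N : ℝ) ^ q / ∏ r, √(max (k r : ℝ) 1) := by
    simp [Real.sqrt_div hN0.le, Finset.prod_div_distrib]
  have hd1 : 0 < ∏ r, stirlingRatio (k r) := Finset.prod_pos fun r _ => stirlingRatio_pos _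
  have hd2 : 0 < ∏ r, √(max (k r : ℝ) 1) := Finset.prod_pos fun r _ =>
    Real.sqrt_pos.2 (lt_max_of_lt_right one_pos)
  have hmult : (Nat.multinomial Finset.univ k : ℝ) =
      stirlingRatio N / (∏ r, stirlingRatio (k r)) * (√(N : ℝ) / ∏ r, √(max (k r : ℝ) 1)) *
        Real.exp (-(N * ∑ r, (k r : ℝ) / N * Real.log ((k r : ℝ) / N))) := by
    rw [← hent, Real.exp_sub]
    have := Real.exp_pos (∑ r, ((k r : ℝ) * Real.log (k r) - k r))
    generalize Real.exp (∑ r, ((k r : ℝ) * Real.log (k r) - k r)) = eK at *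
    generalize Real.exp ((N : ℝ) * Real.log N - N) = eN at *
    field_simp
    linear_combination hfac
  have hexp : Real.exp (-(N * ∑ r, (k r : ℝ) / N * Real.log ((k r : ℝ) / N))) *
      Real.exp (b * N * ∑ r, ((k r : ℝ) / N) ^ p + N * g * ((k 0 : ℝ) / N)) =
      Real.exp (N * (negFreeEnergy p b g (fun r => (k r : ℝ) / N) - negFreeEnergy p b g m)) *
        Real.exp (N * negFreeEnergy p b g m) := by
    rw [← Real.exp_add, ← Real.exp_add]
    congr 1
    simp only [negFreeEnergy]
    ring
  have hsq : √(N : ℝ) ^ q ≠ 0 := by positivity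
  rw [hmult, mul_assoc, hexp, localDensity, hpr, ← hb, ← hg]
  clear_value b g
  field_simp

/-- Integrals against the Potts measure as normalized sums. -/
theorem integral_pottsMeasure {p q N : ℕ} [NeZero q] (β h : ℝ) (f : (Fin N → Fin q) → ℝ) :
    ∫ X, f X ∂(pottsMeasure p q N β h) =
      (∑ X, weight p β h X * f X) / totalWeight p q N β h := by
  have hint : ∀ X : Fin N → Fin q, Integrable f
      (ENNReal.ofReal (weight p β h X / totalWeight p q N β h) • Measure.dirac X) := fun X =>
    (integrable_dirac (by simp)).smul_measure ENNReal.ofReal_ne_top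
  rw [pottsMeasure, integral_finsetSum_measure fun X _ => hint X, Finset.sum_div]
  refine Finset.sum_congr rfl fun X _ => ?_
  have : 0 ≤ weight p β h X / totalWeight p q N β h :=
    div_nonneg (Real.exp_pos _).le (totalWeight_pos p q N β h).le
  rw [integral_smul_measure, integral_dirac, ENNReal.toReal_ofReal this, smul_eq_mul]
  ring

/-- Expectations in the perturbed model as ratios of sums of local densities. -/
theorem integral_perturbedPotts {p q : ℕ} [NeZero q] (β h βbar hbar : ℝ) (m : Fin q → ℝ) {N : ℕ}
    (hN : 0 < N) (φ : (Fin q → ℝ) → ℝ) :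
    ∫ X, φ (fun r => fluctuation m N X r) ∂(perturbedPotts p q β h βbar hbar N) =
      (∑ k ∈ Finset.piAntidiag Finset.univ N,
          localDensity p β h βbar hbar m N k * φ (countFluct m N k)) /
        ∑ k ∈ Finset.piAntidiag Finset.univ N, localDensity p β h βbar hbar m N k := by
  -- This factor does not depend on the counts, so it cancels in the ratio and the partition
  -- function needs no asymptotics.
  set A := Real.exp (N * negFreeEnergy p (β + βbar / √(N : ℝ)) (h + hbar / √(N : ℝ)) m) *
    (√(N : ℝ) / √(N : ℝ) ^ q) with hA
  have hA0 : A ≠ 0 := by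
    have : (0 : ℝ) < N := by positivity
    positivity
  have key : ∀ ψ : (Fin q → ℝ) → ℝ,
      ∑ X : Fin N → Fin q, weight p (β + βbar / √(N : ℝ)) (h + hbar / √(N : ℝ)) X *
          ψ (fun r => fluctuation m N X r) =
        (∑ k ∈ Finset.piAntidiag Finset.univ N,
          localDensity p β h βbar hbar m N k * ψ (countFluct m N k)) * A := by
    intro ψ
    set G : (Fin q → ℕ) → ℝ := fun k => Real.exp ((β + βbar / √(N : ℝ)) * N *
      ∑ r, ((k r : ℝ) / N) ^ p + N * (h + hbar / √(N : ℝ)) * ((k 0 : ℝ) / N)) *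
        ψ (countFluct m N k) with hG
    have h1 : ∀ X : Fin N → Fin q, weight p (β + βbar / √(N : ℝ)) (h + hbar / √(N : ℝ)) X *
          ψ (fun r => fluctuation m N X r) = G (colourCount X) := by
      intro X
      simp only [hG, weight, fluctuation, magnetization_eq]
      rfl
    refine (Finset.sum_congr rfl fun X _ => h1 X).trans ((sum_comp_colourCount G).trans ?_)
    rw [Finset.sum_mul]
    refine Finset.sum_congr rfl fun k hk => ?_
    rw [hG, ← mul_assoc, multinomial_mul_exp_eq β h βbar hbar m hN k (Finset.mem_piAntidiag.1 hk).1]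
    ring
  have hZ := key fun _ => 1
  simp only [mul_one] at hZ
  rw [integral_pottsMeasure, key, totalWeight, hZ, mul_div_mul_right _ _ hA0]

/-! ### Lattice sums as integrals of step functions. -/

/-- The vector with coordinate sum zero that has the given coordinates after the first one. -/
def sumZeroExt {n : ℕ} (w : Fin n → ℝ) : Fin (n + 1) → ℝ := Fin.cons (-∑ i, w i) w

@[simp] theorem sumZeroExt_zero {n : ℕ} (w : Fin n → ℝ) : sumZeroExt w 0 = -∑ i, w i := rfl

@[simp] theorem sumZeroExt_succ {n : ℕ} (w : Fin n → ℝ) (i : Fin n) :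
    sumZeroExt w i.succ = w i := rfl

theorem sum_sumZeroExt {n : ℕ} (w : Fin n → ℝ) : ∑ r, sumZeroExt w r = 0 := by
  simp [Fin.sum_univ_succ]

theorem continuous_sumZeroExt {n : ℕ} : Continuous (sumZeroExt : (Fin n → ℝ) → _) := by
  refine continuous_pi fun r => ?_
  refine Fin.cases ?_ (fun i => ?_) r
  · simp only [sumZeroExt_zero]; fun_prop
  · simp only [sumZeroExt_succ]; fun_prop

/-- The integer vector with total `N` whose last coordinates are the integer parts of `y`. -/
def latticeVec {n : ℕ} (N : ℕ) (y : Fin n → ℝ) : Fin (n + 1) → ℤ :=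
  Fin.cons (N - ∑ i, ⌊y i⌋) fun i => ⌊y i⌋

@[simp] theorem latticeVec_zero {n : ℕ} (N : ℕ) (y : Fin n → ℝ) :
    latticeVec N y 0 = N - ∑ i, ⌊y i⌋ := rfl

@[simp] theorem latticeVec_succ {n : ℕ} (N : ℕ) (y : Fin n → ℝ) (i : Fin n) :
    latticeVec N y i.succ = ⌊y i⌋ := rfl

theorem sum_latticeVec {n : ℕ} (N : ℕ) (y : Fin n → ℝ) : ∑ r, latticeVec N y r = N := by
  simp [Fin.sum_univ_succ]

theorem sum_toNat_latticeVec {n N : ℕ} {y : Fin n → ℝ} (hy : ∀ r, 0 ≤ latticeVec N y r) :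
    ∑ r, (latticeVec N y r).toNat = N := by
  zify
  simp only [Int.toNat_of_nonneg (hy _)]
  exact sum_latticeVec N y

/-- The step function on `ℝ^n` which takes the value `Φ k` on a unit cube for each vector `k` of
natural numbers with total `N`. -/
def latticeStep {n : ℕ} (N : ℕ) (Φ : (Fin (n + 1) → ℕ) → ℝ) (y : Fin n → ℝ) : ℝ :=
  open Classical in
  if ∀ r, 0 ≤ latticeVec N y r then Φ fun r => (latticeVec N y r).toNat else 0

/-- The unit cube on which `latticeStep N Φ` takes the value `Φ k`. -/
def unitCube {n : ℕ} (k : Fin (n + 1) → ℕ) : Set (Fin n → ℝ) :=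
  Set.univ.pi fun i => Set.Ico (k i.succ : ℝ) (k i.succ + 1)

/-- The coordinate `0` is determined by the others through the total `N`, so a cube in `ℝ ^ n` is
enough. -/
theorem mem_unitCube_iff {n N : ℕ} {k : Fin (n + 1) → ℕ}
    (hk : k ∈ Finset.piAntidiag Finset.univ N) (y : Fin n → ℝ) :
    y ∈ unitCube k ↔ ∀ r, latticeVec N y r = k r := by
  have hs := (Finset.mem_piAntidiag.1 hk).1
  have h1 : y ∈ unitCube k ↔ ∀ i : Fin n, ⌊y i⌋ = k i.succ := by
    simp only [unitCube, Set.mem_pi, Set.mem_univ, true_imp_iff, Set.mem_Ico, Int.floor_eq_iff,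
      Int.cast_natCast]
  rw [h1, Fin.forall_fin_succ]
  refine ⟨fun h => ⟨?_, h⟩, fun h => h.2⟩
  rw [Fin.sum_univ_succ] at hs
  rw [latticeVec_zero, Finset.sum_congr rfl fun i _ => h i, ← hs]
  push_cast
  ring

theorem latticeStep_eq {n : ℕ} (N : ℕ) (Φ : (Fin (n + 1) → ℕ) → ℝ) :
    latticeStep N Φ = fun y => ∑ k ∈ Finset.piAntidiag Finset.univ N,
      (unitCube k).indicator (fun _ => Φ k) y := by
  funext y
  by_cases hy : ∀ r, 0 ≤ latticeVec N y r
  · rw [latticeStep, if_pos hy]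
    have hmem : (fun r => (latticeVec N y r).toNat) ∈ Finset.piAntidiag Finset.univ N :=
      Finset.mem_piAntidiag.2 ⟨sum_toNat_latticeVec hy, fun _ _ => Finset.mem_univ _⟩
    rw [Finset.sum_eq_single_of_mem _ hmem, Set.indicator_of_mem]
    · exact (mem_unitCube_iff hmem y).2 fun r => (Int.toNat_of_nonneg (hy r)).symm
    · intro k hk hne
      refine Set.indicator_of_notMem (fun hyk => hne ?_) _
      funext r
      rw [(mem_unitCube_iff hk y).1 hyk r, Int.toNat_natCast]
  · rw [latticeStep, if_neg hy]
    refine (Finset.sum_eq_zero fun k hk => Set.indicator_of_notMem (fun hyk => hy fun r => ?_) _).symm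
    rw [(mem_unitCube_iff hk y).1 hyk r]
    exact Int.natCast_nonneg _

theorem measurableSet_unitCube {n : ℕ} (k : Fin (n + 1) → ℕ) : MeasurableSet (unitCube k) :=
  MeasurableSet.univ_pi fun _ => measurableSet_Ico

theorem volume_unitCube {n : ℕ} (k : Fin (n + 1) → ℕ) : volume (unitCube k) = 1 := by
  simp [unitCube, Real.volume_pi_Ico]

theorem measurable_latticeStep {n : ℕ} (N : ℕ) (Φ : (Fin (n + 1) → ℕ) → ℝ) :
    Measurable (latticeStep N Φ) := by
  rw [latticeStep_eq]
  exact Finset.measurable_fun_sum _ fun k _ =>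
    measurable_const.indicator (measurableSet_unitCube k)

theorem integral_latticeStep {n : ℕ} (N : ℕ) (Φ : (Fin (n + 1) → ℕ) → ℝ) :
    ∫ y, latticeStep N Φ y = ∑ k ∈ Finset.piAntidiag Finset.univ N, Φ k := by
  rw [latticeStep_eq, integral_finsetSum]
  · refine Finset.sum_congr rfl fun k _ => ?_
    rw [integral_indicator_const _ (measurableSet_unitCube k), Measure.real, volume_unitCube]
    simp
  · intro k _
    exact (integrable_indicator_iff (measurableSet_unitCube k)).2
      (integrableOn_const (by simp [volume_unitCube]))

/-- With `R = √N` this is the passage from counts to fluctuations, and `R ^ n` is the number of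
lattice points per unit volume. -/
theorem integral_latticeStep_comp {n : ℕ} (N : ℕ) (Φ : (Fin (n + 1) → ℕ) → ℝ) (a : Fin n → ℝ)
    {R : ℝ} (hR : 0 < R) :
    ∫ w, latticeStep N Φ (a + R • w) =
      (R ^ n)⁻¹ * ∑ k ∈ Finset.piAntidiag Finset.univ N, Φ k := by
  have h := Measure.integral_comp_smul (volume : Measure (Fin n → ℝ))
    (fun y => latticeStep N Φ (a + y)) R
  rw [h, integral_add_left_eq_self (latticeStep N Φ) a, integral_latticeStep]
  simp [abs_of_pos hR]

theorem abs_sqrt_mul_floor_sub_le {N : ℕ} (hN : 0 < N) (a w : ℝ) :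
    |√(N : ℝ) * ((⌊(N : ℝ) * a + √(N : ℝ) * w⌋ : ℝ) / N - a) - w| ≤ (√(N : ℝ))⁻¹ := by
  have hs : 0 < √(N : ℝ) := Real.sqrt_pos.2 (by positivity)
  have hsq : √(N : ℝ) * √(N : ℝ) = N := Real.mul_self_sqrt (Nat.cast_nonneg N)
  set y := (N : ℝ) * a + √(N : ℝ) * w with hy
  have e : √(N : ℝ) * ((⌊y⌋ : ℝ) / N - a) - w = ((⌊y⌋ : ℝ) - y) * (√(N : ℝ))⁻¹ := by
    rw [hy]
    generalize (⌊(N : ℝ) * a + √(N : ℝ) * w⌋ : ℝ) = z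
    clear y hy hN
    generalize √(N : ℝ) = t at *
    rw [← hsq]
    field_simp
    ring
  rw [e, abs_mul, abs_of_pos (inv_pos.2 hs)]
  have h1 : |(⌊y⌋ : ℝ) - y| ≤ 1 := by
    rw [abs_le]
    constructor <;> linarith [Int.floor_le y, Int.lt_floor_add_one y]
  have := inv_pos.2 hs
  nlinarith

theorem tendsto_latticeVec {n : ℕ} {m : Fin (n + 1) → ℝ} (hm1 : ∑ r, m r = 1) (w : Fin n → ℝ)
    (r : Fin (n + 1)) :
    Tendsto (fun N : ℕ => √(N : ℝ) *
        ((latticeVec N (fun i => (N : ℝ) * m i.succ + √(N : ℝ) * w i) r : ℝ) / N - m r))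
      atTop (𝓝 (sumZeroExt w r)) := by
  have hsucc : ∀ i : Fin n, Tendsto (fun N : ℕ => √(N : ℝ) *
      ((⌊(N : ℝ) * m i.succ + √(N : ℝ) * w i⌋ : ℝ) / N - m i.succ)) atTop (𝓝 (w i)) := by
    intro i
    have h1 : Tendsto (fun N : ℕ => (√(N : ℝ))⁻¹) atTop (𝓝 0) :=
      tendsto_inv_atTop_zero.comp (Real.tendsto_sqrt_atTop.comp tendsto_natCast_atTop_atTop)
    rw [tendsto_iff_dist_tendsto_zero]
    refine squeeze_zero' (Eventually.of_forall fun _ => dist_nonneg) ?_ h1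
    filter_upwards [eventually_gt_atTop 0] with N hN
    exact abs_sqrt_mul_floor_sub_le hN _ _
  refine Fin.cases ?_ (fun i => by simpa using hsucc i) r
  have h2 := (tendsto_finsetSum Finset.univ fun i _ => hsucc i).neg
  rw [sumZeroExt_zero]
  refine h2.congr' ?_
  filter_upwards [eventually_gt_atTop 0] with N hN
  have hN0 : (N : ℝ) ≠ 0 := by positivity
  rw [Fin.sum_univ_succ] at hm1
  rw [← Finset.mul_sum, Finset.sum_sub_distrib, ← Finset.sum_div, latticeVec_zero]
  push_cast
  field_simp
  linear_combination (N : ℝ) * hm1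

/-- The limiting density of the fluctuations, in the coordinates of `sumZeroExt`. -/
def limitDensity (p : ℕ) {n : ℕ} (β βbar hbar : ℝ) (m : Fin (n + 1) → ℝ) (w : Fin n → ℝ) : ℝ :=
  Real.exp (quadForm p β m (sumZeroExt w) / 2 +
    ∑ r, driftVec p βbar hbar m r * sumZeroExt w r)

/-- The Riemann sums of the local densities, against a continuous function of at most exponential
growth, converge. -/
theorem tendsto_sum_localDensity {p n : ℕ} (hp : 2 ≤ p) {β h : ℝ} (βbar hbar : ℝ)
    {m : Fin (n + 1) → ℝ} (hpos : ∀ r, 0 < m r) (hm1 : ∑ r, m r = 1) (hc : IsCritical p β h m)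
    (hbound : ∃ c > 0, ∀ x ∈ stdSimplex ℝ (Fin (n + 1)),
      negFreeEnergy p β h x - negFreeEnergy p β h m ≤ -c * ∑ r, (x r - m r) ^ 2)
    {φ : (Fin (n + 1) → ℝ) → ℝ} (hφ : Continuous φ) {K : ℝ}
    (hK : ∀ u, |φ u| ≤ K * Real.exp (K * ∑ r, |u r|)) :
    Tendsto (fun N : ℕ => (√(N : ℝ) ^ n)⁻¹ * ∑ k ∈ Finset.piAntidiag Finset.univ N,
        localDensity p β h βbar hbar m N k * φ (countFluct m N k)) atTop
      (𝓝 (∫ w, localConst m * limitDensity p β βbar hbar m w * φ (sumZeroExt w))) := by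
  obtain ⟨C, c, hC, hc0, hdens⟩ := exists_localDensity_le βbar hbar hpos hm1 hbound
  have hK0 : 0 ≤ K := by
    have := (abs_nonneg _).trans (hK 0)
    exact nonneg_of_mul_nonneg_left this (Real.exp_pos _)
  set Φ : ℕ → (Fin (n + 1) → ℕ) → ℝ := fun N k =>
    localDensity p β h βbar hbar m N k * φ (countFluct m N k) with hΦ
  set y : ℕ → (Fin n → ℝ) → Fin n → ℝ := fun N w i =>
    (N : ℝ) * m i.succ + √(N : ℝ) * w i with hy
  -- Half of the decay `c` absorbs the growth of `φ`; passing from `u` to `w` through `w ^ 2 ≤ 2 u ^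
  -- 2 + 2` halves the rest to `c / 4` and costs `c / 2 * n`.
  set C' : ℝ := C * K * Real.exp (∑ _r : Fin (n + 1), K ^ 2 / (2 * c) + c / 2 * n) with hC'
  have hC'0 : 0 ≤ C' := by positivity
  have hle : ∀ N : ℕ, 0 < N → ∀ w, ‖latticeStep N (Φ N) (y N w)‖ ≤
      C' * ∏ i, Real.exp (-(c / 4) * w i ^ 2) := by
    intro N hN w
    have hN0 : (0 : ℝ) < N := by positivity
    by_cases hv : ∀ r, 0 ≤ latticeVec N (y N w) r
    swap
    · rw [latticeStep, if_neg hv, norm_zero]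
      positivity
    rw [latticeStep, if_pos hv]
    set k : Fin (n + 1) → ℕ := fun r => (latticeVec N (y N w) r).toNat with hk
    set u := countFluct m N k with hu
    have hkr : ∀ r, (k r : ℝ) = latticeVec N (y N w) r := fun r => by
      have := Int.toNat_of_nonneg (hv r)
      exact_mod_cast congrArg (Int.cast : ℤ → ℝ) this
    have hus : ∀ i : Fin n, w i ^ 2 ≤ 2 * u i.succ ^ 2 + 2 := by
      intro i
      have h1 : |u i.succ - w i| ≤ 1 := by
        have h2 := abs_sqrt_mul_floor_sub_le hN (m i.succ) (w i)
        have h3 : u i.succ = √(N : ℝ) *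
            ((⌊(N : ℝ) * m i.succ + √(N : ℝ) * w i⌋ : ℝ) / N - m i.succ) := by
          rw [hu, countFluct, hkr]
          rfl
        rw [h3]
        exact h2.trans (inv_le_one_of_one_le₀ (Real.one_le_sqrt.2 (by exact_mod_cast hN)))
      have h2 : (u i.succ - w i) ^ 2 ≤ 1 := by rwa [sq_le_one_iff_abs_le_one]
      nlinarith [sq_nonneg (2 * u i.succ - w i)]
    have hsumsq : ∑ i, w i ^ 2 ≤ 2 * ∑ r, u r ^ 2 + 2 * n := by
      have h1 := Finset.sum_le_sum fun i (_ : i ∈ Finset.univ) => hus i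
      rw [Finset.sum_add_distrib, ← Finset.mul_sum] at h1
      simp only [Finset.sum_const, Finset.card_univ, Fintype.card_fin, nsmul_eq_mul] at h1
      rw [Fin.sum_univ_succ]
      nlinarith [sq_nonneg (u 0)]
    have habs : K * ∑ r, |u r| - c * ∑ r, u r ^ 2 ≤
        ∑ _r : Fin (n + 1), K ^ 2 / (2 * c) - c / 2 * ∑ r, u r ^ 2 := by
      have := Finset.sum_le_sum fun r (_ : r ∈ Finset.univ) => exp_mul_abs_sub_le hc0 K (u r)
      rwa [Finset.sum_sub_distrib, Finset.sum_sub_distrib, ← Finset.mul_sum, ← Finset.mul_sum,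
        ← Finset.mul_sum] at this
    have h1 := hdens N k hN (sum_toNat_latticeVec hv)
    rw [← Real.exp_sum, ← Finset.mul_sum, Real.norm_eq_abs, hΦ, abs_mul,
      abs_of_nonneg (localDensity_nonneg _ _ _ _ _ _ _ _)]
    calc localDensity p β h βbar hbar m N k * |φ u|
        ≤ C * Real.exp (-c * ∑ r, u r ^ 2) * (K * Real.exp (K * ∑ r, |u r|)) :=
          mul_le_mul h1 (hK u) (abs_nonneg _) (by positivity)
      _ = C * K * Real.exp (K * ∑ r, |u r| - c * ∑ r, u r ^ 2) := by
          rw [sub_eq_add_neg, Real.exp_add, ← neg_mul]; ring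
      _ ≤ C * K * Real.exp ((∑ _r : Fin (n + 1), K ^ 2 / (2 * c) + c / 2 * n) +
            -(c / 4) * ∑ i, w i ^ 2) := by
          refine mul_le_mul_of_nonneg_left (Real.exp_le_exp.2 ?_) (by positivity)
          nlinarith
      _ = C' * Real.exp (-(c / 4) * ∑ i, w i ^ 2) := by
          rw [Real.exp_add, hC']; ring
  have hlim : ∀ w, Tendsto (fun N => latticeStep N (Φ N) (y N w)) atTop
      (𝓝 (localConst m * limitDensity p β βbar hbar m w * φ (sumZeroExt w))) := by
    intro w
    set k : ℕ → Fin (n + 1) → ℕ := fun N r => (latticeVec N (y N w) r).toNat with hk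
    have hlat := tendsto_latticeVec hm1 w
    -- For fixed `w` the lattice point is eventually a genuine count vector, as its ratios to `N`
    -- tend to `m r > 0`.
    have hv : ∀ᶠ N in atTop, ∀ r, 0 ≤ latticeVec N (y N w) r := by
      rw [eventually_all]
      intro r
      have h1 := (tendsto_sub_of_tendsto_sqrt_mul (hlat r)).add_const (m r)
      simp only [sub_add_cancel, zero_add] at h1
      filter_upwards [h1.eventually (lt_mem_nhds (hpos r)), eventually_gt_atTop 0] with N h2 hN
      have hN0 : (0 : ℝ) < N := by positivity
      rw [div_pos_iff_of_pos_right hN0] at h2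
      exact_mod_cast h2.le
    have hkr : ∀ᶠ N in atTop, ∀ r, (k N r : ℝ) = latticeVec N (y N w) r := by
      filter_upwards [hv] with N hN r
      have := Int.toNat_of_nonneg (hN r)
      exact_mod_cast congrArg (Int.cast : ℤ → ℝ) this
    have hflu : ∀ r, Tendsto (fun N : ℕ => countFluct m N (k N) r) atTop
        (𝓝 (sumZeroExt w r)) := fun r => (hlat r).congr' <| by
      filter_upwards [hkr] with N hN
      rw [countFluct, hN r]
    have h1 := tendsto_localDensity hp βbar hbar hpos hm1 hc
      (hv.mono fun N hN => sum_toNat_latticeVec hN) hflu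
    have h2 := (hφ.tendsto (sumZeroExt w)).comp (tendsto_pi_nhds.2 hflu)
    refine (h1.mul h2).congr' ?_
    filter_upwards [hv] with N hN
    rw [latticeStep, if_pos hN]
    rfl
  have hint : Integrable fun w : Fin n → ℝ => C' * ∏ i, Real.exp (-(c / 4) * w i ^ 2) :=
    (Integrable.fintype_prod fun _ => integrable_exp_neg_mul_sq (by positivity)).const_mul C'
  have hmeas : ∀ N, Measurable fun w => latticeStep N (Φ N) (y N w) := fun N =>
    (measurable_latticeStep N (Φ N)).comp (by fun_prop)
  refine (tendsto_integral_filter_of_dominated_convergence _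
    (Eventually.of_forall fun N => (hmeas N).aestronglyMeasurable)
    ((eventually_gt_atTop 0).mono fun N hN => Eventually.of_forall fun w => hle N hN w) hint
    (Eventually.of_forall hlim)).congr' ?_
  filter_upwards [eventually_gt_atTop 0] with N hN
  have hs : 0 < √(N : ℝ) := Real.sqrt_pos.2 (by positivity)
  exact integral_latticeStep_comp N (Φ N) (fun i => (N : ℝ) * m i.succ) hs

/-! ### Recognizing a normal law from its exponential moments. -/

/-- The Gaussian exponential moments are finite on all of `ℝ`, so equality of the real moment
generating functions extends analytically to the complex plane, which determines the law. -/
theorem map_eq_gaussianReal_of_mgf_eq {Ω : Type*} [MeasurableSpace Ω] {μ : Measure Ω}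
    [IsProbabilityMeasure μ] {X : Ω → ℝ} (hX : AEMeasurable X μ) (a : ℝ) (v : NNReal)
    (h : ∀ θ, mgf X μ θ = Real.exp (a * θ + v * θ ^ 2 / 2)) : μ.map X = gaussianReal a v := by
  have hmgf : mgf id (gaussianReal a v) = mgf X μ := by
    rw [mgf_id_gaussianReal]
    exact funext fun θ => (h θ).symm
  have heq := eqOn_complexMGF_of_mgf hmgf
  simp only [integrableExpSet_id_gaussianReal, interior_univ, Set.mem_univ, Set.ofPred_true,
    Set.eqOn_univ] at heq
  simpa using (Measure.ext_of_complexMGF_eq aemeasurable_id hX heq).symm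

/-- A probability measure with the moment generating function of a multivariate normal law is
this normal law. -/
theorem eq_multivariateGaussian_of_integral_exp {ι : Type*} [Fintype ι] [DecidableEq ι]
    {μ : Measure (EuclideanSpace ℝ ι)} [IsProbabilityMeasure μ] {S : Matrix ι ι ℝ}
    (hS : S.PosSemidef) (a : EuclideanSpace ℝ ι)
    (h : ∀ t : EuclideanSpace ℝ ι, ∫ x, Real.exp (inner ℝ x t) ∂μ =
      Real.exp (inner ℝ t a + t ⬝ᵥ S.mulVec t / 2)) :
    μ = multivariateGaussian a S := by
  refine Measure.ext_of_charFun (funext fun t => ?_)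
  have hv : 0 ≤ t ⬝ᵥ S.mulVec t := by simpa using hS.dotProduct_mulVec_nonneg (t : ι → ℝ)
  set X : EuclideanSpace ℝ ι → ℝ := fun x => inner ℝ x t with hXdef
  have hX : Measurable X := by fun_prop
  -- Testing the hypothesis on all multiples of `t` identifies the one-dimensional projection along
  -- `t`.
  have hmap : μ.map X = gaussianReal (inner ℝ t a) (Real.toNNReal (t ⬝ᵥ S.mulVec t)) := by
    refine map_eq_gaussianReal_of_mgf_eq hX.aemeasurable _ _ fun θ => ?_
    have h1 := h (θ • t)
    have h2 : (θ • t).ofLp ⬝ᵥ S.mulVec (θ • t).ofLp = (t ⬝ᵥ S.mulVec t) * θ ^ 2 := by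
      simp [Matrix.mulVec_smul]
      ring
    rw [h2] at h1
    simp only [inner_smul_right, inner_smul_left] at h1
    rw [mgf, hXdef]
    simp only [RCLike.conj_to_real] at h1
    rw [h1, mul_comm θ, Real.coe_toNNReal _ hv]
  have h1 : charFun μ t = charFun (μ.map X) 1 := by
    rw [charFun_apply, charFun_apply, integral_map hX.aemeasurable (by fun_prop)]
    simp [hXdef]
  rw [h1, hmap, charFun_gaussianReal, charFun_multivariateGaussian hS]
  congr 1
  simp [Real.coe_toNNReal _ hv]

/-! ### Inverting a diagonal form on the sum-zero hyperplane. -/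

/-- `S` inverts the quadratic form with coefficients `c` on the hyperplane `∑ r, t r = 0`. -/
def IsHyperplaneInverse {ι : Type*} [Fintype ι] (S : Matrix ι ι ℝ) (c : ι → ℝ) : Prop :=
  ∀ t : ι → ℝ, ∑ r, S.mulVec t r = 0 ∧ ∃ μ, ∀ r, c r * S.mulVec t r = t r - μ

theorem IsHyperplaneInverse.dotProduct_eq {ι : Type*} [Fintype ι] {S : Matrix ι ι ℝ} {c : ι → ℝ}
    (hS : IsHyperplaneInverse S c) (t : ι → ℝ) {u : ι → ℝ} (hu : ∑ r, u r = 0) :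
    t ⬝ᵥ u = ∑ r, c r * S.mulVec t r * u r := by
  obtain ⟨μ, hμ⟩ := (hS t).2
  simp only [hμ, sub_mul, Finset.sum_sub_distrib, ← Finset.mul_sum, hu, mul_zero, sub_zero]
  rfl

/-- Completing the square. -/
theorem IsHyperplaneInverse.complete_square {ι : Type*} [Fintype ι] {S : Matrix ι ι ℝ} {c : ι → ℝ}
    (hS : IsHyperplaneInverse S c) (t : ι → ℝ) {u : ι → ℝ} (hu : ∑ r, u r = 0) :
    t ⬝ᵥ u - (∑ r, c r * u r ^ 2) / 2 =
      t ⬝ᵥ S.mulVec t / 2 - (∑ r, c r * (u r - S.mulVec t r) ^ 2) / 2 := by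
  have h1 := hS.dotProduct_eq t hu
  have h2 := hS.dotProduct_eq t (hS t).1
  have h3 : ∑ r, c r * (u r - S.mulVec t r) ^ 2 = ∑ r, c r * u r ^ 2 -
      2 * ∑ r, c r * S.mulVec t r * u r + ∑ r, c r * S.mulVec t r * S.mulVec t r := by
    rw [Finset.mul_sum, ← Finset.sum_sub_distrib, ← Finset.sum_add_distrib]
    exact Finset.sum_congr rfl fun r _ => by ring
  rw [h3]
  linarith

/-- The form of `S` at `t` is the form with coefficients `c` at `S t`, a vector of the hyperplane.
-/
theorem IsHyperplaneInverse.posSemidef {ι : Type*} [Fintype ι] {S : Matrix ι ι ℝ} {c : ι → ℝ}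
    (hS : IsHyperplaneInverse S c) (hsymm : S.IsHermitian)
    (hc : ∀ u : ι → ℝ, ∑ r, u r = 0 → 0 ≤ ∑ r, c r * u r ^ 2) : S.PosSemidef := by
  refine .of_dotProduct_mulVec_nonneg hsymm fun t => ?_
  rw [star_trivial, hS.dotProduct_eq t (hS t).1]
  simpa only [pow_two, mul_assoc] using hc _ (hS t).1

/-! ### Admissible test functions. -/

/-- Continuous functions of at most exponential growth. -/
def HasExpGrowth {ι : Type*} [Fintype ι] (φ : (ι → ℝ) → ℝ) : Prop :=
  Continuous φ ∧ ∃ K : ℝ, ∀ u, |φ u| ≤ K * Real.exp (K * ∑ r, |u r|)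

theorem abs_dotProduct_le {ι : Type*} [Fintype ι] (t u : ι → ℝ) :
    |t ⬝ᵥ u| ≤ (∑ r, |t r|) * ∑ r, |u r| := by
  rw [dotProduct, Finset.mul_sum]
  refine (Finset.abs_sum_le_sum_abs _ _).trans (Finset.sum_le_sum fun r _ => ?_)
  rw [abs_mul]
  exact mul_le_mul_of_nonneg_right
    (Finset.single_le_sum (f := fun r => |t r|) (fun _ _ => abs_nonneg _) (Finset.mem_univ r))
    (abs_nonneg _)

theorem hasExpGrowth_exp_dotProduct {ι : Type*} [Fintype ι] (t : ι → ℝ) :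
    HasExpGrowth fun u : ι → ℝ => Real.exp (t ⬝ᵥ u) := by
  refine ⟨by unfold dotProduct; fun_prop, 1 + ∑ r, |t r|, fun u => ?_⟩
  have ht : 0 ≤ ∑ r, |t r| := Finset.sum_nonneg fun _ _ => abs_nonneg _
  have hu : 0 ≤ ∑ r, |u r| := Finset.sum_nonneg fun _ _ => abs_nonneg _
  rw [Real.abs_exp]
  have h1 : Real.exp (t ⬝ᵥ u) ≤ Real.exp ((1 + ∑ r, |t r|) * ∑ r, |u r|) := by
    refine Real.exp_le_exp.2 (((le_abs_self _).trans (abs_dotProduct_le t u)).trans ?_)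
    nlinarith
  nlinarith [Real.exp_pos ((1 + ∑ r, |t r|) * ∑ r, |u r|)]

theorem hasExpGrowth_of_bounded {ι : Type*} [Fintype ι] {φ : (ι → ℝ) → ℝ} (hφ : Continuous φ)
    {B : ℝ} (hB : ∀ u, |φ u| ≤ B) : HasExpGrowth φ := by
  have hB0 : 0 ≤ B := (abs_nonneg _).trans (hB 0)
  refine ⟨hφ, B, fun u => (hB u).trans ?_⟩
  have : 0 ≤ B * ∑ r, |u r| := mul_nonneg hB0 (Finset.sum_nonneg fun _ _ => abs_nonneg _)
  exact le_mul_of_one_le_right hB0 (Real.one_le_exp this)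

theorem hasExpGrowth_monomial {ι : Type*} [Fintype ι] (a : ι → ℕ) :
    HasExpGrowth fun u : ι → ℝ => ∏ r, u r ^ a r := by
  refine ⟨by fun_prop, ∏ r, ((a r).factorial : ℝ), fun u => ?_⟩
  set K : ℝ := ∏ r, ((a r).factorial : ℝ) with hK
  have hK1 : 1 ≤ K := by
    rw [hK]
    exact_mod_cast Nat.one_le_iff_ne_zero.2
      (Finset.prod_ne_zero_iff.2 fun r _ => (a r).factorial_ne_zero)
  have h1 : |∏ r, u r ^ a r| ≤ K * Real.exp (∑ r, |u r|) := by
    rw [Finset.abs_prod, Real.exp_sum, hK, ← Finset.prod_mul_distrib]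
    refine Finset.prod_le_prod (fun _ _ => abs_nonneg _) fun r _ => ?_
    have := Real.pow_div_factorial_le_exp |u r| (abs_nonneg _) (a r)
    rw [div_le_iff₀ (by positivity)] at this
    rw [abs_pow]
    linarith
  have hu : 0 ≤ ∑ r, |u r| := Finset.sum_nonneg fun _ _ => abs_nonneg _
  refine h1.trans (mul_le_mul_of_nonneg_left (Real.exp_le_exp.2 ?_) (by linarith))
  nlinarith

/-! ### The limit law through its density on the hyperplane. -/

section LimitLaw

variable {p n : ℕ} {β : ℝ} {m : Fin (n + 1) → ℝ}

theorem continuous_limitDensity (p : ℕ) (β βbar hbar : ℝ) (m : Fin (n + 1) → ℝ) :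
    Continuous (limitDensity p β βbar hbar m) := by
  have h1 := (continuous_quadForm p β m).comp (continuous_sumZeroExt (n := n))
  have h2 : ∀ r, Continuous fun w : Fin n → ℝ => sumZeroExt w r := fun r =>
    (continuous_apply r).comp continuous_sumZeroExt
  unfold limitDensity
  refine Real.continuous_exp.comp ((h1.div_const 2).add ?_)
  exact continuous_finsetSum _ fun r _ => (h2 r).const_mul _

theorem integrable_limitDensity_mul
    (hneg : ∀ t : Fin (n + 1) → ℝ, ∑ r, t r = 0 → t ≠ 0 → quadForm p β m t < 0)
    (βbar hbar : ℝ) {φ : (Fin (n + 1) → ℝ) → ℝ} (hφ : HasExpGrowth φ) :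
    Integrable fun w => limitDensity p β βbar hbar m w * φ (sumZeroExt w) := by
  obtain ⟨c, hc, hquad⟩ := exists_quadForm_le hneg
  obtain ⟨hφc, K, hK⟩ := hφ
  have hK0 : 0 ≤ K := by
    have := (abs_nonneg _).trans (hK 0)
    exact nonneg_of_mul_nonneg_left this (Real.exp_pos _)
  set v := driftVec p βbar hbar m with hv
  set D := ∑ r, |v r| + K with hD
  have hint : Integrable fun w : Fin n → ℝ =>
      (K * Real.exp (∑ _r : Fin (n + 1), D ^ 2 / (2 * (c / 2)))) *
        ∏ i, Real.exp (-(c / 4) * w i ^ 2) :=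
    (Integrable.fintype_prod fun _ => integrable_exp_neg_mul_sq (by positivity)).const_mul _
  refine hint.mono' ((continuous_limitDensity p β βbar hbar m).mul
    (hφc.comp continuous_sumZeroExt)).aestronglyMeasurable (Eventually.of_forall fun w => ?_)
  set u := sumZeroExt w with hu
  have h1 := hquad u (sum_sumZeroExt w)
  have h2 := (le_abs_self _).trans (abs_dotProduct_le v u)
  have h3 := Finset.sum_le_sum fun r (_ : r ∈ Finset.univ) =>
    exp_mul_abs_sub_le (half_pos hc) D (u r)
  rw [Finset.sum_sub_distrib, Finset.sum_sub_distrib, ← Finset.mul_sum, ← Finset.mul_sum,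
    ← Finset.mul_sum] at h3
  have h4 : ∑ i, w i ^ 2 ≤ ∑ r, u r ^ 2 := by
    rw [Fin.sum_univ_succ]
    simpa [hu] using sq_nonneg (u 0)
  rw [← Real.exp_sum, ← Finset.mul_sum, mul_assoc, ← Real.exp_add, norm_mul, Real.norm_eq_abs,
    Real.norm_eq_abs, limitDensity, Real.abs_exp]
  calc Real.exp (quadForm p β m u / 2 + ∑ r, v r * u r) * |φ u|
      ≤ Real.exp (quadForm p β m u / 2 + ∑ r, v r * u r) * (K * Real.exp (K * ∑ r, |u r|)) :=
        mul_le_mul_of_nonneg_left (hK u) (Real.exp_pos _).le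
    _ = K * Real.exp (quadForm p β m u / 2 + v ⬝ᵥ u + K * ∑ r, |u r|) := by
        rw [Real.exp_add (_ + _), dotProduct]; ring
    _ ≤ _ := by
        refine mul_le_mul_of_nonneg_left (Real.exp_le_exp.2 ?_) hK0
        rw [hD, add_mul] at h3
        nlinarith

/-- The normalizing constant of `limitDensity`. -/
def limitMass (p : ℕ) (β βbar hbar : ℝ) (m : Fin (n + 1) → ℝ) : ℝ :=
  ∫ w, limitDensity p β βbar hbar m w

theorem integrable_limitDensity
    (hneg : ∀ t : Fin (n + 1) → ℝ, ∑ r, t r = 0 → t ≠ 0 → quadForm p β m t < 0)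
    (βbar hbar : ℝ) : Integrable (limitDensity p β βbar hbar m) := by
  simpa using integrable_limitDensity_mul hneg βbar hbar
    (hasExpGrowth_of_bounded (φ := fun _ => 1) continuous_const (B := 1) (by simp))

theorem limitMass_pos
    (hneg : ∀ t : Fin (n + 1) → ℝ, ∑ r, t r = 0 → t ≠ 0 → quadForm p β m t < 0)
    (βbar hbar : ℝ) : 0 < limitMass p β βbar hbar m :=
  integral_exp_pos (integrable_limitDensity hneg βbar hbar)

/-- The probability measure with density proportional to `limitDensity` on the hyperplane. -/
def densityLaw (p : ℕ) (β βbar hbar : ℝ) (m : Fin (n + 1) → ℝ) :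
    Measure (EuclideanSpace ℝ (Fin (n + 1))) :=
  (volume.withDensity fun w => ENNReal.ofReal
    (limitDensity p β βbar hbar m w / limitMass p β βbar hbar m)).map
      fun w => WithLp.toLp 2 (sumZeroExt w)

theorem measurable_toLp_sumZeroExt :
    Measurable fun w : Fin n → ℝ => WithLp.toLp 2 (sumZeroExt w) :=
  ((PiLp.continuous_toLp 2 _).comp continuous_sumZeroExt).measurable

theorem isProbabilityMeasure_densityLaw
    (hneg : ∀ t : Fin (n + 1) → ℝ, ∑ r, t r = 0 → t ≠ 0 → quadForm p β m t < 0)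
    (βbar hbar : ℝ) : IsProbabilityMeasure (densityLaw p β βbar hbar m) := by
  have hZ := limitMass_pos hneg βbar hbar
  have : IsProbabilityMeasure (volume.withDensity fun w => ENNReal.ofReal
      (limitDensity p β βbar hbar m w / limitMass p β βbar hbar m)) := by
    constructor
    rw [withDensity_apply _ MeasurableSet.univ, Measure.restrict_univ,
      ← ofReal_integral_eq_lintegral_ofReal ((integrable_limitDensity hneg βbar hbar).div_const _)
        (Eventually.of_forall fun w => div_nonneg (Real.exp_pos _).le hZ.le),
      integral_div, ← limitMass, div_self hZ.ne', ENNReal.ofReal_one]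
  exact Measure.isProbabilityMeasure_map measurable_toLp_sumZeroExt.aemeasurable

theorem integral_densityLaw
    (hneg : ∀ t : Fin (n + 1) → ℝ, ∑ r, t r = 0 → t ≠ 0 → quadForm p β m t < 0)
    (βbar hbar : ℝ) {φ : (Fin (n + 1) → ℝ) → ℝ} (hφ : Continuous φ) :
    ∫ x, φ (fun r => x r) ∂(densityLaw p β βbar hbar m) =
      (∫ w, limitDensity p β βbar hbar m w * φ (sumZeroExt w)) /
        limitMass p β βbar hbar m := by
  have hZ := limitMass_pos hneg βbar hbar
  have hc : Continuous fun x : EuclideanSpace ℝ (Fin (n + 1)) => φ (fun r => x r) :=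
    hφ.comp (PiLp.continuous_ofLp 2 _)
  rw [densityLaw, integral_map measurable_toLp_sumZeroExt.aemeasurable hc.aestronglyMeasurable,
    integral_withDensity_eq_integral_toReal_smul
      ((continuous_limitDensity p β βbar hbar m).measurable.div_const _).ennreal_ofReal
      (Eventually.of_forall fun _ => ENNReal.ofReal_lt_top), ← integral_div]
  refine integral_congr_ae (Eventually.of_forall fun w => ?_)
  have : 0 ≤ limitDensity p β βbar hbar m w / limitMass p β βbar hbar m :=
    div_nonneg (Real.exp_pos _).le hZ.le
  simp only [ENNReal.toReal_ofReal this, smul_eq_mul]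
  ring

theorem integrable_densityLaw
    (hneg : ∀ t : Fin (n + 1) → ℝ, ∑ r, t r = 0 → t ≠ 0 → quadForm p β m t < 0)
    (βbar hbar : ℝ) {φ : (Fin (n + 1) → ℝ) → ℝ} (hφ : HasExpGrowth φ) :
    Integrable (fun x : EuclideanSpace ℝ (Fin (n + 1)) => φ (fun r => x r))
      (densityLaw p β βbar hbar m) := by
  have hZ := limitMass_pos hneg βbar hbar
  have hc : Continuous fun x : EuclideanSpace ℝ (Fin (n + 1)) => φ (fun r => x r) :=
    hφ.1.comp (PiLp.continuous_ofLp 2 _)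
  rw [densityLaw, integrable_map_measure hc.aestronglyMeasurable
      measurable_toLp_sumZeroExt.aemeasurable,
    integrable_withDensity_iff_integrable_smul'
      ((continuous_limitDensity p β βbar hbar m).measurable.div_const _).ennreal_ofReal
      (Eventually.of_forall fun _ => ENNReal.ofReal_lt_top)]
  refine ((integrable_limitDensity_mul hneg βbar hbar hφ).div_const
    (limitMass p β βbar hbar m)).congr (Eventually.of_forall fun w => ?_)
  have : 0 ≤ limitDensity p β βbar hbar m w / limitMass p β βbar hbar m :=
    div_nonneg (Real.exp_pos _).le hZ.le
  simp only [ENNReal.toReal_ofReal this, smul_eq_mul, Function.comp]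
  ring

/-- Exponential moments of `limitDensity`, up to the mass of the centred Gaussian. -/
theorem integral_limitDensity_mul_exp {S : Matrix (Fin (n + 1)) (Fin (n + 1)) ℝ}
    (hS : IsHyperplaneInverse S fun r => -kFun'' p β (m r)) (βbar hbar : ℝ)
    (t : Fin (n + 1) → ℝ) :
    ∫ w, limitDensity p β βbar hbar m w * Real.exp (t ⬝ᵥ sumZeroExt w) =
      Real.exp ((driftVec p βbar hbar m + t) ⬝ᵥ S.mulVec (driftVec p βbar hbar m + t) / 2) *
        ∫ w : Fin n → ℝ, Real.exp (quadForm p β m (sumZeroExt w) / 2) := by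
  set v := driftVec p βbar hbar m + t with hv
  set z := S.mulVec v with hz
  -- The centre `S v` has coordinate sum zero, so subtracting it is a translation in the free
  -- coordinates, under which Lebesgue measure is invariant.
  set z' : Fin n → ℝ := fun i => z i.succ with hz'
  have hzz : sumZeroExt z' = z := by
    have h0 := (hS v).1
    rw [Fin.sum_univ_succ] at h0
    funext r
    refine Fin.cases ?_ (fun i => rfl) r
    rw [sumZeroExt_zero]
    linarith
  rw [← integral_sub_right_eq_self
    (fun w : Fin n → ℝ => Real.exp (quadForm p β m (sumZeroExt w) / 2)) z',
    ← integral_const_mul]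
  refine integral_congr_ae (Eventually.of_forall fun w => ?_)
  have hsub : ∀ r, sumZeroExt (w - z') r = sumZeroExt w r - z r := by
    intro r
    rw [← hzz]
    refine Fin.cases ?_ (fun i => rfl) r
    simp
    ring
  have h1 := hS.complete_square v (sum_sumZeroExt w)
  simp only [limitDensity, quadForm_eq, hsub]
  rw [← Real.exp_add, ← Real.exp_add]
  congr 1
  simp only [neg_mul, Finset.sum_neg_distrib] at h1
  have h2 : v ⬝ᵥ sumZeroExt w =
      ∑ r, driftVec p βbar hbar m r * sumZeroExt w r + t ⬝ᵥ sumZeroExt w := by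
    rw [hv, add_dotProduct]
    rfl
  rw [h2] at h1
  linarith

/-- In the quotient of exponential moments the centred mass cancels, so no determinant is computed;
the exponents differ by `t · S v + t · S t / 2` since `S` is symmetric. -/
theorem densityLaw_eq_multivariateGaussian
    (hneg : ∀ t : Fin (n + 1) → ℝ, ∑ r, t r = 0 → t ≠ 0 → quadForm p β m t < 0)
    {S : Matrix (Fin (n + 1)) (Fin (n + 1)) ℝ} (hpsd : S.PosSemidef)
    (hS : IsHyperplaneInverse S fun r => -kFun'' p β (m r)) (βbar hbar : ℝ) :
    densityLaw p β βbar hbar m =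
      multivariateGaussian (WithLp.toLp 2 (S.mulVec (driftVec p βbar hbar m))) S := by
  have := isProbabilityMeasure_densityLaw hneg βbar hbar
  refine eq_multivariateGaussian_of_integral_exp hpsd _ fun t => ?_
  set v := driftVec p βbar hbar m with hv
  have hexp := integral_limitDensity_mul_exp hS βbar hbar t
  have hZ := integral_limitDensity_mul_exp hS βbar hbar 0
  simp only [zero_dotProduct, Real.exp_zero, mul_one, add_zero] at hZ
  have hZpos := limitMass_pos hneg βbar hbar
  rw [limitMass, hZ] at hZpos
  set G := ∫ w : Fin n → ℝ, Real.exp (quadForm p β m (sumZeroExt w) / 2) with hG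
  have hG0 : G ≠ 0 := fun h => by simp [h] at hZpos
  have h1 : ∀ x : EuclideanSpace ℝ (Fin (n + 1)),
      Real.exp (inner ℝ x t) = Real.exp (t ⬝ᵥ fun r => x r) := fun x => by
    congr 1
  simp only [h1]
  rw [integral_densityLaw hneg βbar hbar (hasExpGrowth_exp_dotProduct (t : Fin (n + 1) → ℝ)).1,
    hexp, limitMass, hZ, mul_div_mul_right _ _ hG0, ← Real.exp_sub]
  congr 1
  have hsymm : v ⬝ᵥ S.mulVec t = t ⬝ᵥ S.mulVec v := by
    have hT : S.transpose = S := by simpa using hpsd.1.eq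
    rw [Matrix.dotProduct_mulVec, ← Matrix.mulVec_transpose, hT, dotProduct_comm]
  have hinner : inner ℝ t (WithLp.toLp 2 (S.mulVec v)) = t ⬝ᵥ S.mulVec v := by
    rw [dotProduct_comm]
    rfl
  rw [hinner, ← hv, Matrix.mulVec_add, add_dotProduct, dotProduct_add, dotProduct_add, hsymm]
  ring

end LimitLaw

/-! ### The matrix `Σ` is the hyperplane inverse of the Hessian. -/

theorem isHermitian_sigmaMatrix (p q : ℕ) [NeZero q] (β h s : ℝ) :
    (sigmaMatrix p q β h s).IsHermitian := by
  refine Matrix.IsHermitian.ext fun i j => ?_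
  simp only [sigmaMatrix, Matrix.smul_apply, Matrix.of_apply, star_trivial]
  by_cases hi : i = 0 <;> by_cases hj : j = 0 <;> simp [hi, hj, eq_comm]

/-- The entries of `Σ v` in closed form. -/
theorem sigmaMatrix_mulVec {p n : ℕ} (β h s : ℝ) (t : Fin (n + 1) → ℝ) :
    let D := -(((n + 1 : ℕ) : ℝ) ^ 2 / (((n + 1 : ℕ) : ℝ) - 1)) *
      iteratedDeriv 2 (fFun p (n + 1) β h) s
    let ρ := kRatio p (n + 1) β s
    (sigmaMatrix p (n + 1) β h s).mulVec t 0 = D⁻¹ * (n * t 0 - ∑ i : Fin n, t i.succ) ∧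
      ∀ i : Fin n, (sigmaMatrix p (n + 1) β h s).mulVec t i.succ =
        D⁻¹ * (-t 0 + (1 + n * ρ) * t i.succ - ρ * ∑ j : Fin n, t j.succ) := by
  intro D ρ
  refine ⟨?_, fun i => ?_⟩
  · rw [sigmaMatrix, Matrix.smul_mulVec, Pi.smul_apply, smul_eq_mul]
    congr 1
    simp [Matrix.mulVec, dotProduct, Fin.sum_univ_succ]
    ring
  · rw [sigmaMatrix, Matrix.smul_mulVec, Pi.smul_apply, smul_eq_mul]
    congr 1
    have h1 : ∀ j : Fin n, (if i = j then (1 + ((n : ℝ) + 1 - 2) * ρ) * t j.succ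
        else -(ρ * t j.succ)) = -ρ * t j.succ + if i = j then (1 + n * ρ) * t j.succ else 0 := by
      intro j
      split_ifs <;> ring
    simp [Matrix.mulVec, dotProduct, Fin.sum_univ_succ, Fin.succ_ne_zero, Fin.succ_inj]
    change -t 0 + ∑ j : Fin n, (if i = j then (1 + ((n : ℝ) + 1 - 2) * ρ) * t j.succ
      else -(ρ * t j.succ)) = _
    simp only [h1, Finset.sum_add_distrib, ← Finset.mul_sum, Finset.sum_ite_eq, Finset.mem_univ,
      if_true]
    ring

/-- With `a = -k''(x₀)` and `b = -k''(x₁)`, the scalar in `Σ` is `(n a + b)⁻¹`, and for `n ≥ 2` one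
has `b ρ = a`; the rest is linear algebra. -/
theorem isHyperplaneInverse_sigmaMatrix {p n : ℕ} (hp : 2 ≤ p) (hn : 1 ≤ n) {β h s : ℝ}
    (hs : s ∈ Set.Ico (0 : ℝ) 1)
    (hneg : ∀ t : Fin (n + 1) → ℝ, ∑ r, t r = 0 → t ≠ 0 →
      quadForm p β (xvec (n + 1) s) t < 0) :
    IsHyperplaneInverse (sigmaMatrix p (n + 1) β h s)
      fun r => -kFun'' p β (xvec (n + 1) s r) := by
  obtain ⟨h0, h1⟩ := (eventually_coords_pos (q := n + 1) hs).self_of_nhds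
  have hn0 : (0 : ℝ) < n := by exact_mod_cast hn
  set x₀ : ℝ := (1 + (((n + 1 : ℕ) : ℝ) - 1) * s) / ((n + 1 : ℕ) : ℝ) with hx₀
  set x₁ : ℝ := (1 - s) / ((n + 1 : ℕ) : ℝ) with hx₁
  set a := -kFun'' p β x₀ with ha
  set b := -kFun'' p β x₁ with hb
  have hxz : xvec (n + 1) s 0 = x₀ := xvec_zero _ _
  have hxs : ∀ i : Fin n, xvec (n + 1) s i.succ = x₁ := fun i => xvec_of_ne s i.succ_ne_zero
  have hD : -(((n + 1 : ℕ) : ℝ) ^ 2 / (((n + 1 : ℕ) : ℝ) - 1)) *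
      iteratedDeriv 2 (fFun p (n + 1) β h) s = n * a + b := by
    rw [iteratedDeriv_two_fFun hp β h hs, ← hx₀, ← hx₁, ha, hb]
    push_cast
    rw [add_sub_cancel_right]
    field_simp
    ring
  have hDpos : 0 < n * a + b := by
    obtain ⟨i₀⟩ : Nonempty (Fin n) := ⟨⟨0, hn⟩⟩
    -- On the vector `(n, -1, …, -1)` the form equals `-n (n a + b)`.
    have h2 := hneg (sumZeroExt fun _ : Fin n => (-1 : ℝ)) (sum_sumZeroExt _) (fun h => by
      have := congrFun h i₀.succ
      simp at this)
    rw [quadForm_eq, Fin.sum_univ_succ] at h2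
    simp only [hxz, hxs, sumZeroExt_zero, sumZeroExt_succ] at h2
    simp at h2
    rw [ha, hb]
    nlinarith
  -- For `n = 1` the second factor vanishes, so `ρ` is irrelevant and `b` may have any sign. For `n
  -- ≥ 2` a difference of two basis vectors other than the first gives `b > 0`, so the quotient `ρ`
  -- is meaningful.
  have hρ : ∀ t : Fin (n + 1) → ℝ, ∀ i : Fin n,
      (b * kRatio p (n + 1) β s - a) * (n * t i.succ - ∑ j : Fin n, t j.succ) = 0 := by
    intro t i
    rcases hn.eq_or_lt with rfl | hn2
    · have : i = 0 := Subsingleton.elim _ _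
      simp [this]
    · have hb0 : 0 < b := by
        obtain ⟨i₀, i₁, hne⟩ : ∃ i₀ i₁ : Fin n, i₀ ≠ i₁ := ⟨⟨0, hn⟩, ⟨1, hn2⟩, by simp⟩
        have h2 := hneg (Pi.single i₀.succ 1 - Pi.single i₁.succ 1)
          (by simp [Finset.sum_sub_distrib]) (fun h => by
            have := congrFun h i₀.succ
            simp [hne] at this)
        have h3 : ∀ r, kFun'' p β (xvec (n + 1) s r) *
            (Pi.single i₀.succ 1 - Pi.single i₁.succ 1 :
              Fin (n + 1) → ℝ) r ^ 2 =
            (if r = i₀.succ then -b else 0) +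
              if r = i₁.succ then -b else 0 := by
          intro r
          by_cases hr0 : r = i₀.succ
          · subst hr0
            simp [hb, hxs, hne]
          · by_cases hr1 : r = i₁.succ
            · subst hr1
              simp [hb, hxs, hne.symm]
            · simp [hr0, hr1]
        rw [quadForm_eq, Finset.sum_congr rfl fun r _ => h3 r, Finset.sum_add_distrib] at h2
        simp at h2
        linarith
      have : b * kRatio p (n + 1) β s = a := by
        have hk : kFun'' p β x₁ ≠ 0 := by
          intro hk
          rw [hb, hk] at hb0
          simp at hb0
        rw [kRatio, ← hx₀, ← hx₁, iteratedDeriv_two_kFun hp β h0, iteratedDeriv_two_kFun hp β h1,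
          ha, hb]
        field_simp
      rw [this, sub_self, zero_mul]
  intro t
  have hDne := hDpos.ne'
  obtain ⟨e0, e1⟩ := sigmaMatrix_mulVec (p := p) β h s t
  rw [hD] at e0 e1
  set T := ∑ j : Fin n, t j.succ with hT
  -- The multiplier is the one that makes the solution of the diagonal system sum to zero.
  refine ⟨?_, (b * t 0 + a * T) / (n * a + b), fun r => ?_⟩
  · rw [Fin.sum_univ_succ, e0, Finset.sum_congr rfl fun i _ => e1 i, ← Finset.mul_sum,
      Finset.sum_sub_distrib, Finset.sum_add_distrib, ← Finset.mul_sum, ← hT]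
    simp
    ring
  · refine Fin.cases ?_ (fun i => ?_) r
    · simp only [e0, hxz, ← ha]
      linear_combination t 0 * inv_mul_cancel₀ hDne
    · simp only [e1, hxs, ← hb]
      field_simp
      linear_combination hρ t i

end TensorPotts

end

/-! ### Assembly of the limit theorem. -/

theorem theorem2p2 (p q : ℕ) [NeZero q] (hp : 2 ≤ p) (hq : 2 ≤ q) (β h βbar hbar : ℝ)
    (hreg : TensorPotts.IsRegular p q β h)
    (m : Fin q → ℝ) (hm : m ∈ TensorPotts.maximizers p q β h) :
    ∃ s : ℝ, s ∈ Set.Ico (0 : ℝ) 1 ∧ m = TensorPotts.xvec q s ∧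
      (TensorPotts.sigmaMatrix p q β h s).PosSemidef ∧
      TendstoInDistribution (fun N : ℕ => TensorPotts.fluctuation m N) atTop
        (id : EuclideanSpace ℝ (Fin q) → EuclideanSpace ℝ (Fin q))
        (fun N : ℕ => TensorPotts.perturbedPotts p q β h βbar hbar N)
        (TensorPotts.limitLaw p q β h βbar hbar s m) ∧
      ∀ a : Fin q → ℕ,
        Integrable (fun w : EuclideanSpace ℝ (Fin q) => ∏ r, w r ^ a r)
          (TensorPotts.limitLaw p q β h βbar hbar s m) ∧
        Tendsto
          (fun N : ℕ => ∫ X, ∏ r, TensorPotts.fluctuation m N X r ^ a r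
            ∂(TensorPotts.perturbedPotts p q β h βbar hbar N))
          atTop
          (𝓝 (∫ w, ∏ r, w r ^ a r ∂(TensorPotts.limitLaw p q β h βbar hbar s m))) := by
  obtain ⟨hβ, hh, m', hm', hneg⟩ := hreg
  obtain rfl : m = m' := by rwa [hm'] at hm
  obtain ⟨s, hs, rfl⟩ := TensorPotts.exists_eq_xvec hp hq hβ hh hm'
  obtain ⟨n, rfl⟩ : ∃ n, q = n + 1 := ⟨q - 1, by omega⟩
  obtain rfl : ‹NeZero (n + 1)› = Nat.instNeZeroSucc := Subsingleton.elim _ _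
  set m := TensorPotts.xvec (n + 1) s with hmdef
  have hpos : ∀ r, 0 < m r := TensorPotts.xvec_pos hs
  have hm1 : ∑ r, m r = 1 := TensorPotts.sum_xvec _ s
  have hc : TensorPotts.IsCritical p β h m := TensorPotts.exists_multiplier hq hs hm
  have hinv := TensorPotts.isHyperplaneInverse_sigmaMatrix hp (by omega) (h := h) hs hneg
  have hpsd : (TensorPotts.sigmaMatrix p (n + 1) β h s).PosSemidef := by
    refine hinv.posSemidef (TensorPotts.isHermitian_sigmaMatrix _ _ _ _ _) fun u hu => ?_
    simp only [neg_mul, Finset.sum_neg_distrib, Left.nonneg_neg_iff]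
    by_cases hu0 : u = 0
    · simp [hu0]
    · exact (hneg u hu hu0).le
  have hlaw : TensorPotts.limitLaw p (n + 1) β h βbar hbar s m =
      TensorPotts.densityLaw p β βbar hbar m :=
    (TensorPotts.densityLaw_eq_multivariateGaussian hneg hpsd hinv βbar hbar).symm
  have hbound := TensorPotts.exists_negFreeEnergy_sub_le hp hpos hc hm' hneg
  -- An expectation is a quotient of two lattice sums, the lower one with test function `1`; the
  -- scaling `√N ^ n` and `localConst` cancel.
  have hmain : ∀ φ : (Fin (n + 1) → ℝ) → ℝ, TensorPotts.HasExpGrowth φ →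
      Tendsto (fun N : ℕ => ∫ X, φ (fun r => TensorPotts.fluctuation m N X r)
          ∂(TensorPotts.perturbedPotts p (n + 1) β h βbar hbar N)) atTop
        (𝓝 (∫ w, φ (fun r => w r) ∂(TensorPotts.limitLaw p (n + 1) β h βbar hbar s m))) := by
    intro φ hφ
    obtain ⟨K, hK⟩ := hφ.2
    have h1 := TensorPotts.tendsto_sum_localDensity hp βbar hbar hpos hm1 hc hbound hφ.1 hK
    have h2 := TensorPotts.tendsto_sum_localDensity hp βbar hbar hpos hm1 hc hbound
      (φ := fun _ => 1) continuous_const (K := 1) (fun u => by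
        have : 0 ≤ ∑ r, |u r| := Finset.sum_nonneg fun _ _ => abs_nonneg _
        simpa using this)
    have hC := TensorPotts.localConst_pos hpos
    have hZ := TensorPotts.limitMass_pos hneg βbar hbar
    simp only [mul_one, mul_assoc, integral_const_mul] at h1 h2
    have h3 := h1.div h2 (mul_pos hC hZ).ne'
    rw [mul_div_mul_left _ _ hC.ne'] at h3
    rw [hlaw, TensorPotts.integral_densityLaw hneg βbar hbar hφ.1]
    refine h3.congr' ?_
    filter_upwards [eventually_gt_atTop 0] with N hN
    have hs : 0 < √(N : ℝ) := Real.sqrt_pos.2 (by positivity)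
    rw [Pi.div_apply, mul_div_mul_left _ _ (by positivity),
      TensorPotts.integral_perturbedPotts β h βbar hbar m hN φ]
  refine ⟨s, hs, rfl, hpsd, ⟨fun N => (measurable_of_finite _).aemeasurable, aemeasurable_id, ?_⟩,
    fun a => ⟨?_, ?_⟩⟩
  · refine ProbabilityMeasure.tendsto_iff_forall_integral_tendsto.2 fun f => ?_
    have := hmain (fun u => f (WithLp.toLp 2 u)) (TensorPotts.hasExpGrowth_of_bounded
      (f.continuous.comp (PiLp.continuous_toLp 2 _)) fun u => f.norm_coe_le_norm _)
    change Tendsto (fun N : ℕ => ∫ x, f x ∂((TensorPotts.perturbedPotts p (n + 1) β h βbar hbar N).map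
      (TensorPotts.fluctuation m N))) atTop
        (𝓝 (∫ x, f x ∂((TensorPotts.limitLaw p (n + 1) β h βbar hbar s m).map id)))
    rw [Measure.map_id]
    refine this.congr fun N => ?_
    rw [integral_map (measurable_of_finite _).aemeasurable
      f.continuous.measurable.aestronglyMeasurable]
  · rw [hlaw]
    exact TensorPotts.integrable_densityLaw hneg βbar hbar (TensorPotts.hasExpGrowth_monomial a)
  · exact hmain _ (TensorPotts.hasExpGrowth_monomial a)
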